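/- **Conventions.** $\mathbf{Hilb}$ is the symmetric monoidal category of complex Hilbert spaces and bounded linear maps, with the Hilbertian tensor product $\otimes_2$ (the completion of the algebraic tensor product) and its unitary associativity constraint $a$ and symmetry. $\mathbf{FdHilb}$ is its full subcategory of finite-dimensional spaces. A *commutative Hilbertian Frobenius semigroup* is a pair $(H,\mu)$ where $H$ is a Hilbert space and $\mu\colon H\otimes_2 H\to H$ is a bounded linear map that is associative and commutative and satisfies the Frobenius condition $$\mu^\dagger\mu=(\mu\otimes_2 \mathrm{id})\,a^{-1}\,(\mathrm{id}\otimes_2\mu^\dagger)=(\mathrm{id}\otimes_2\mu)\,a\,(\mu^\dagger\otimes_2\mathrm{id}).$$ A morphism $f\colon(H,\mu)\to(K,\gamma)$ is a bounded linear map with $f\mu=\gamma(f\otimes_2 f)$. This is the category ${}_c\mathbf{FrobSem}(\mathbf{Hilb})$. Write $xy=\mu(x\otimes y)$. The *Jacobson radical* $J(H,\mu)$ is the intersection of the maximal modular ideals (and is $H$ if there are none); a modular ideal is an ideal $I$ with some $e\in H$ such that $x-ex\in I$ for all $x$, and it is maximal if it is maximal among the proper ideals. $(H,\mu)$ is *semisimple*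 if $J(H,\mu)=0$; ${}_{\mathsf{semisimple},c}\mathbf{FrobSem}(\mathbf{Hilb})$ is the full subcategory of the semisimple ones, and ${}_{\mathsf{semisimple},c}\mathbf{FrobSem}(\mathbf{FdHilb})$ that of the finite-dimensional semisimple ones. An element $g\neq0$ is *group-like* if $\mu^\dagger(g)=g\otimes g$. A *weighted pointed set* is a triple $(X,x_0,\alpha)$ with $x_0\in X$ and $\alpha\colon X\setminus\{x_0\}\to[C,+\infty[$ for some real $C>0$. A morphism $(X,x_0,\alpha)\to(Y,y_0,\beta)$ is a map $f\colon X\to Y$ with $f(x_0)=y_0$, such that $f^{-1}(\{y\})$ is finite for every $y\neq y_0$, and such that for some $M\ge0$ one has $\sum_{x\in f^{-1}(\{y\})}\alpha(x)\le M\beta(y)$ for all $y\ne y_0$. This is the category $\mathbf{WSet}_\bullet$. $\mathbf{FinSet}_\bullet$ is the category of finite pointed sets and base-point preserving maps. **The functor $\ell^2_\bullet\colon\mathbf{WSet}_\bullet^{\mathsf{op}}\to{}_c\mathbf{FrobSem}(\mathbf{Hilb})$.** $\ell^2_\bullet(X,x_0,\alpha)$ is the Hilbert space of the functions $u\colon X\to\mathbb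 C$ with $u(x_0)=0$ and $\sum_{x\neq x_0}\alpha(x)|u(x)|^2<\infty$, with the inner product weighted by $\alpha$ and the pointwise product; $\ell^2_\bullet(f)(u)=u\circ f$. Its values are semisimple. **The functor $\mathrm{Min}_\bullet\colon{}_c\mathbf{FrobSem}(\mathbf{Hilb})\to\mathbf{WSet}_\bullet^{\mathsf{op}}$.** Let $\mathrm{Min}(H,\mu)$ be the set of the minimal (non-zero) ideals contained in $J(H,\mu)^\perp$ (all the minimal ideals if $(H,\mu)$ is semisimple). Each $I\in\mathrm{Min}(H,\mu)$ is $\mathbb Cg_I$ for a unique group-like element $g_I$; put $g_0=0$. Then $\mathrm{Min}_\bullet(H,\mu)=(\mathrm{Min}(H,\mu)\cup\{0\},\,0,\,I\mapsto\|g_I\|^{-2})$, and a morphism $f\colon(H,\mu)\to(K,\gamma)$ is sent to the map $\mathrm{Min}(K,\gamma)\cup\{0\}\to \mathrm{Min}(H,\mu)\cup\{0\}$, $J\mapsto\mathbb C f^\dagger(g_J)$. **Theorem.** There is an adjunction $$\mathrm{Min}_\bullet\dashv\ell^2_\bullet\colon\mathbf{WSet}_\bullet^{\mathsf{op}}\to{}_c\mathbf{FrobSem}(\mathbf{Hilb}),$$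 and it restricts (with the same unit and counit) to an adjoint equivalence $$\mathrm{Min}_\bullet\dashv\ell^2_\bullet\colon\mathbf{WSet}_\bullet^{\mathsf{op}}\simeq{}_{\mathsf{semisimple},c}\mathbf{FrobSem}(\mathbf{Hilb}).$$ In particular ${}_{\mathsf{semisimple},c}\mathbf{FrobSem}(\mathbf{FdHilb})\simeq\mathbf{FinSet}_\bullet^{\mathsf{op}}$, by an equivalence that sends $(H,\mu)$ to the pointed set $(\mathrm{Min}(H,\mu)\cup\{0\},0)$ and is $J\mapsto\mathbb Cf^\dagger(g_J)$ on morphisms, up to natural isomorphism. -/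

import Mathlib

open scoped TensorProduct
open CategoryTheory

universe u

namespace HilbFrob

noncomputable section

section HilbertTensor

/-- The Hilbertian tensor product: the completion of the algebraic tensor product for the inner
product `⟪x ⊗ y, x' ⊗ y'⟫ = ⟪x, x'⟫ * ⟪y, y'⟫`. -/
abbrev HTensor (H K : Type*) [NormedAddCommGroup H] [InnerProductSpace ℂ H]
    [NormedAddCommGroup K] [InnerProductSpace ℂ K] : Type _ :=
  UniformSpace.Completion (H ⊗[ℂ] K)

variable {H K L H' K' : Type*}
  [NormedAddCommGroup H] [InnerProductSpace ℂ H]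
  [NormedAddCommGroup K] [InnerProductSpace ℂ K]
  [NormedAddCommGroup L] [InnerProductSpace ℂ L]
  [NormedAddCommGroup H'] [InnerProductSpace ℂ H']
  [NormedAddCommGroup K'] [InnerProductSpace ℂ K']

/-- The elementary tensor `x ⊗ y` in the Hilbertian tensor product. -/
def htmul (x : H) (y : K) : HTensor H K := ((x ⊗ₜ[ℂ] y : H ⊗[ℂ] K) : HTensor H K)

/-- The elementary tensors, as a bounded bilinear map. -/
def htmulL : H →L[ℂ] K →L[ℂ] HTensor H K :=
  (ContinuousLinearMap.compL ℂ K (H ⊗[ℂ] K) (HTensor H K) UniformSpace.Completion.toComplL) ∘L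
    TensorProduct.mkL ℂ H K

theorem htmulL_apply (x : H) (y : K) : htmulL x y = htmul x y := rfl

theorem htmul_add (x : H) (y y' : K) : htmul x (y + y') = htmul x y + htmul x y' := by
  simp [← htmulL_apply]

theorem htmul_smul (c : ℂ) (x : H) (y : K) : htmul x (c • y) = c • htmul x y := by
  simp [← htmulL_apply]

theorem smul_htmul (c : ℂ) (x : H) (y : K) : htmul (c • x) y = c • htmul x y := by
  simp [← htmulL_apply]

theorem inner_htmul (x x' : H) (y y' : K) :
    inner ℂ (htmul x y) (htmul x' y') = inner ℂ x x' * inner ℂ y y' := by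
  simp [htmul]

theorem norm_htmul (x : H) (y : K) : ‖htmul x y‖ = ‖x‖ * ‖y‖ := by
  simp [htmul]

/-- A closed subspace that contains the elementary tensors is everything. -/
theorem htensor_mem (S : Submodule ℂ (HTensor H K)) (hc : IsClosed (S : Set (HTensor H K)))
    (ht : ∀ x y, htmul x y ∈ S) (t : HTensor H K) : t ∈ S := by
  induction t using UniformSpace.Completion.induction_on with
  | hp => exact hc
  | ih t =>
    induction t using TensorProduct.induction_on with
    | zero => rw [UniformSpace.Completion.coe_zero]; exact S.zero_mem
    | tmul x y => exact ht x y
    | add s t hs ht' => rw [UniformSpace.Completion.coe_add]; exact S.add_mem hs ht'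

theorem htensor_ext {E : Type*} [NormedAddCommGroup E] [NormedSpace ℂ E]
    {f g : HTensor H K →L[ℂ] E} (h : ∀ x y, f (htmul x y) = g (htmul x y)) : f = g := by
  ext t
  exact htensor_mem (LinearMap.eqLocus (f : HTensor H K →ₗ[ℂ] E) g)
    (isClosed_eq f.continuous g.continuous) h t

theorem htensor_ext_inner {s t : HTensor H K}
    (h : ∀ x y, inner ℂ s (htmul x y) = inner ℂ t (htmul x y)) : s = t := by
  refine ext_inner_right ℂ fun v => ?_
  have : innerSL ℂ s = innerSL ℂ t := htensor_ext h
  exact congrArg (fun φ => φ v) this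

/-- The Hilbertian tensor product of two bounded linear maps. -/
def hmap (f : H →L[ℂ] H') (g : K →L[ℂ] K') : HTensor H K →L[ℂ] HTensor H' K' :=
  (TensorProduct.mapL f g).completion

@[simp] theorem hmap_htmul (f : H →L[ℂ] H') (g : K →L[ℂ] K') (x : H) (y : K) :
    hmap f g (htmul x y) = htmul (f x) (g y) := by
  simp [hmap, htmul]

/-- The unitary symmetry constraint `x ⊗ y ↦ y ⊗ x`. -/
def hcomm (H K : Type*) [NormedAddCommGroup H] [InnerProductSpace ℂ H]
    [NormedAddCommGroup K] [InnerProductSpace ℂ K] : HTensor H K ≃ₗᵢ[ℂ] HTensor K H :=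
  (TensorProduct.commIsometry ℂ H K).toLinearEquiv.extendOfIsometry
    (UniformSpace.Completion.toComplₗᵢ (𝕜 := ℂ) (E := H ⊗[ℂ] K)).toLinearMap
    (UniformSpace.Completion.toComplₗᵢ (𝕜 := ℂ) (E := K ⊗[ℂ] H)).toLinearMap
    UniformSpace.Completion.denseRange_coe UniformSpace.Completion.denseRange_coe
    (by intro x; simp)

@[simp] theorem hcomm_htmul (x : H) (y : K) : hcomm H K (htmul x y) = htmul y x :=
  LinearEquiv.extendOfIsometry_eq (TensorProduct.commIsometry ℂ H K).toLinearEquiv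
    (UniformSpace.Completion.toComplₗᵢ (𝕜 := ℂ) (E := H ⊗[ℂ] K)).toLinearMap
    (UniformSpace.Completion.toComplₗᵢ (𝕜 := ℂ) (E := K ⊗[ℂ] H)).toLinearMap
    UniformSpace.Completion.denseRange_coe UniformSpace.Completion.denseRange_coe
    (by intro x; simp) (x ⊗ₜ y)

/-- The isometric inclusion of `(H ⊗ K) ⊗ L` in `(H ⊗₂ K) ⊗₂ L`. -/
def leftIncl (H K L : Type*) [NormedAddCommGroup H] [InnerProductSpace ℂ H]
    [NormedAddCommGroup K] [InnerProductSpace ℂ K] [NormedAddCommGroup L] [InnerProductSpace ℂ L] :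
    (H ⊗[ℂ] K) ⊗[ℂ] L →ₗᵢ[ℂ] HTensor (HTensor H K) L :=
  UniformSpace.Completion.toComplₗᵢ.comp
    (TensorProduct.mapIsometry UniformSpace.Completion.toComplₗᵢ LinearIsometry.id)

/-- The isometric inclusion of `H ⊗ (K ⊗ L)` in `H ⊗₂ (K ⊗₂ L)`. -/
def rightIncl (H K L : Type*) [NormedAddCommGroup H] [InnerProductSpace ℂ H]
    [NormedAddCommGroup K] [InnerProductSpace ℂ K] [NormedAddCommGroup L] [InnerProductSpace ℂ L] :
    H ⊗[ℂ] (K ⊗[ℂ] L) →ₗᵢ[ℂ] HTensor H (HTensor K L) :=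
  UniformSpace.Completion.toComplₗᵢ.comp
    (TensorProduct.mapIsometry LinearIsometry.id UniformSpace.Completion.toComplₗᵢ)

theorem leftIncl_tmul (x : H) (y : K) (z : L) :
    leftIncl H K L ((x ⊗ₜ y) ⊗ₜ z) = htmul (htmul x y) z := rfl

theorem rightIncl_tmul (x : H) (y : K) (z : L) :
    rightIncl H K L (x ⊗ₜ (y ⊗ₜ z)) = htmul x (htmul y z) := rfl

theorem denseRange_leftIncl : DenseRange (leftIncl H K L) := by
  intro t
  let S := (LinearMap.range (leftIncl H K L).toLinearMap).topologicalClosure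
  have hS : IsClosed (S : Set (HTensor (HTensor H K) L)) :=
    Submodule.isClosed_topologicalClosure _
  suffices h : t ∈ S by
    rwa [← SetLike.mem_coe, Submodule.topologicalClosure_coe] at h
  refine htensor_mem S hS (fun s z => ?_) t
  refine htensor_mem (S.comap (htmulL.flip z : HTensor H K →L[ℂ] _).toLinearMap)
    (hS.preimage (htmulL.flip z : HTensor H K →L[ℂ] _).continuous) (fun x y => ?_) s
  exact Submodule.le_topologicalClosure _ ⟨(x ⊗ₜ y) ⊗ₜ z, rfl⟩

theorem denseRange_rightIncl : DenseRange (rightIncl H K L) := by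
  intro t
  let S := (LinearMap.range (rightIncl H K L).toLinearMap).topologicalClosure
  have hS : IsClosed (S : Set (HTensor H (HTensor K L))) :=
    Submodule.isClosed_topologicalClosure _
  suffices h : t ∈ S by
    rwa [← SetLike.mem_coe, Submodule.topologicalClosure_coe] at h
  refine htensor_mem S hS (fun x s => ?_) t
  refine htensor_mem (S.comap (htmulL x : HTensor K L →L[ℂ] _).toLinearMap)
    (hS.preimage (htmulL x : HTensor K L →L[ℂ] _).continuous) (fun y z => ?_) s
  exact Submodule.le_topologicalClosure _ ⟨x ⊗ₜ (y ⊗ₜ z), rfl⟩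

/-- The unitary associativity constraint `(x ⊗ y) ⊗ z ↦ x ⊗ (y ⊗ z)`. -/
def hassoc (H K L : Type*) [NormedAddCommGroup H] [InnerProductSpace ℂ H]
    [NormedAddCommGroup K] [InnerProductSpace ℂ K] [NormedAddCommGroup L] [InnerProductSpace ℂ L] :
    HTensor (HTensor H K) L ≃ₗᵢ[ℂ] HTensor H (HTensor K L) :=
  (TensorProduct.assocIsometry ℂ H K L).toLinearEquiv.extendOfIsometry
    (leftIncl H K L).toLinearMap (rightIncl H K L).toLinearMap
    denseRange_leftIncl denseRange_rightIncl
    (by intro x; simp)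

@[simp] theorem hassoc_htmul (x : H) (y : K) (z : L) :
    hassoc H K L (htmul (htmul x y) z) = htmul x (htmul y z) :=
  LinearEquiv.extendOfIsometry_eq (TensorProduct.assocIsometry ℂ H K L).toLinearEquiv
    (leftIncl H K L).toLinearMap (rightIncl H K L).toLinearMap
    denseRange_leftIncl denseRange_rightIncl _ ((x ⊗ₜ y) ⊗ₜ z)

@[simp] theorem hassoc_symm_htmul (x : H) (y : K) (z : L) :
    (hassoc H K L).symm (htmul x (htmul y z)) = htmul (htmul x y) z := by
  rw [← hassoc_htmul, LinearIsometryEquiv.symm_apply_apply]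

/-- Two bounded maps on `(H ⊗₂ K) ⊗₂ L` that agree on elementary tensors are equal. -/
theorem htensor_ext₃ {E : Type*} [NormedAddCommGroup E] [NormedSpace ℂ E]
    {f g : HTensor (HTensor H K) L →L[ℂ] E}
    (h : ∀ x y z, f (htmul (htmul x y) z) = g (htmul (htmul x y) z)) : f = g := by
  refine htensor_ext fun s z => ?_
  have : f ∘L (htmulL.flip z) = g ∘L (htmulL.flip z) := htensor_ext fun x y => h x y z
  exact congrArg (fun φ => φ s) this

end HilbertTensor

/-! ### Commutative Hilbertian algebras -/

/-- A commutative semigroup object in the symmetric monoidal category of complex Hilbert spaces. -/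
structure HilbAlg : Type (u + 1) where
  carrier : Type u
  [normed : NormedAddCommGroup carrier]
  [ips : InnerProductSpace ℂ carrier]
  [complete : CompleteSpace carrier]
  /-- the multiplication -/
  mul : HTensor carrier carrier →L[ℂ] carrier
  assoc : mul ∘L hmap mul (ContinuousLinearMap.id ℂ carrier) =
    mul ∘L hmap (ContinuousLinearMap.id ℂ carrier) mul ∘L
      (hassoc carrier carrier carrier : _ →L[ℂ] _)
  comm : mul ∘L (hcomm carrier carrier : _ →L[ℂ] _) = mul

namespace HilbAlg

instance : CoeSort HilbAlg.{u} (Type u) := ⟨HilbAlg.carrier⟩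

attribute [instance] HilbAlg.normed HilbAlg.ips HilbAlg.complete

/-- A morphism of semigroup objects: a bounded linear map that commutes with the
multiplications. -/
@[ext]
structure Hom (A B : HilbAlg.{u}) : Type u where
  toCLM : A →L[ℂ] B
  map_mul : toCLM ∘L A.mul = B.mul ∘L hmap toCLM toCLM

variable (A : HilbAlg.{u})

/-- The bilinear product `x y = μ (x ⊗ y)`. -/
def prod (x y : A) : A := A.mul (htmul x y)

/-- The operator of multiplication by `x`. -/
def mulOp (x : A) : A →L[ℂ] A := A.mul ∘L htmulL x

/-- The comultiplication `μ†`. -/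
def comul : A →L[ℂ] HTensor A A := ContinuousLinearMap.adjoint A.mul

theorem mulOp_apply (x y : A) : A.mulOp x y = A.prod x y := rfl

variable {A}

theorem prod_comm (x y : A) : A.prod x y = A.prod y x := by
  have := congrArg (fun φ => φ (htmul x y)) A.comm
  simpa [prod] using this.symm

theorem prod_assoc (x y z : A) : A.prod (A.prod x y) z = A.prod x (A.prod y z) := by
  have := congrArg (fun φ => φ (htmul (htmul x y) z)) A.assoc
  simpa [prod] using this

theorem prod_add (x y z : A) : A.prod x (y + z) = A.prod x y + A.prod x z :=
  (A.mulOp x).map_add y z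

theorem prod_sub (x y z : A) : A.prod x (y - z) = A.prod x y - A.prod x z :=
  (A.mulOp x).map_sub y z

theorem prod_smul (c : ℂ) (x y : A) : A.prod x (c • y) = c • A.prod x y :=
  (A.mulOp x).map_smul c y

theorem prod_zero (x : A) : A.prod x 0 = 0 := (A.mulOp x).map_zero

theorem add_prod (x y z : A) : A.prod (x + y) z = A.prod x z + A.prod y z := by
  rw [prod_comm, prod_add, prod_comm z x, prod_comm z y]

theorem sub_prod (x y z : A) : A.prod (x - y) z = A.prod x z - A.prod y z := by
  rw [prod_comm, prod_sub, prod_comm z x, prod_comm z y]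

theorem smul_prod (c : ℂ) (x y : A) : A.prod (c • x) y = c • A.prod x y := by
  rw [prod_comm, prod_smul, prod_comm]

theorem zero_prod (x : A) : A.prod 0 x = 0 := by rw [prod_comm, prod_zero]

theorem norm_prod_le (x y : A) : ‖A.prod x y‖ ≤ ‖A.mul‖ * (‖x‖ * ‖y‖) := by
  rw [← norm_htmul]; exact A.mul.le_opNorm _

theorem inner_comul (x y z : A) :
    inner ℂ (A.comul x) (htmul y z) = inner ℂ x (A.prod y z) :=
  ContinuousLinearMap.adjoint_inner_left _ _ _

namespace Hom

variable {A B C : HilbAlg.{u}}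

theorem map_prod (f : Hom A B) (x y : A) : f.toCLM (A.prod x y) =
    B.prod (f.toCLM x) (f.toCLM y) := by
  have := congrArg (fun φ => φ (htmul x y)) f.map_mul
  simpa [prod] using this

/-- A bounded linear map that is multiplicative on elements is a morphism. -/
def ofProd (f : A →L[ℂ] B) (h : ∀ x y, f (A.prod x y) = B.prod (f x) (f y)) : Hom A B where
  toCLM := f
  map_mul := htensor_ext fun x y => by simpa [prod] using h x y

/-- The identity morphism. -/
def id (A : HilbAlg.{u}) : Hom A A := ofProd (ContinuousLinearMap.id ℂ A) fun _ _ => rfl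

/-- Composition of morphisms. -/
def comp (f : Hom A B) (g : Hom B C) : Hom A C :=
  ofProd (g.toCLM ∘L f.toCLM) fun x y => by simp [map_prod]

end Hom

instance : Category HilbAlg.{u} where
  Hom := Hom
  id := Hom.id
  comp := Hom.comp

@[simp] theorem id_toCLM (A : HilbAlg.{u}) :
    Hom.toCLM (𝟙 A) = ContinuousLinearMap.id ℂ A := rfl

@[simp] theorem comp_toCLM {A B C : HilbAlg.{u}} (f : A ⟶ B) (g : B ⟶ C) :
    Hom.toCLM (f ≫ g) = Hom.toCLM g ∘L Hom.toCLM f := rfl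

variable (A)

/-- The Frobenius condition, both halves of it. -/
def IsFrobenius : Prop :=
  A.comul ∘L A.mul =
      hmap A.mul (ContinuousLinearMap.id ℂ A) ∘L ((hassoc A A A).symm : _ →L[ℂ] _) ∘L
        hmap (ContinuousLinearMap.id ℂ A) A.comul ∧
    A.comul ∘L A.mul =
      hmap (ContinuousLinearMap.id ℂ A) A.mul ∘L (hassoc A A A : _ →L[ℂ] _) ∘L
        hmap A.comul (ContinuousLinearMap.id ℂ A)

variable {A}

/-- An ideal of the underlying (complex, commutative, possibly non-unital) algebra. -/
def IsIdeal (I : Submodule ℂ A) : Prop := ∀ x, ∀ y ∈ I, A.prod x y ∈ I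

/-- A minimal ideal: minimal among the non-zero ideals. -/
def IsMinimalIdeal (I : Submodule ℂ A) : Prop :=
  Minimal (fun K : Submodule ℂ A => IsIdeal K ∧ K ≠ ⊥) I

/-- A modular ideal: one with a unit `e` modulo the ideal. -/
def IsModular (I : Submodule ℂ A) : Prop := ∃ e : A, ∀ x, x - A.prod e x ∈ I

/-- A maximal modular ideal: a modular ideal that is maximal among the proper ideals. -/
def IsMaximalModular (I : Submodule ℂ A) : Prop :=
  IsModular I ∧ Maximal (fun K : Submodule ℂ A => IsIdeal K ∧ K ≠ ⊤) I

variable (A)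

/-- The Jacobson radical: the intersection of the maximal modular ideals. -/
def radical : Submodule ℂ A := sInf {I | IsMaximalModular I}

/-- Semisimplicity: the Jacobson radical is trivial. -/
def IsSemisimple : Prop := A.radical = ⊥

variable {A}

/-- A group-like element: `g ≠ 0` with `μ† g = g ⊗ g`. -/
def IsGroupLike (g : A) : Prop := g ≠ 0 ∧ A.comul g = htmul g g

theorem IsGroupLike.inner_prod {g : A} (hg : IsGroupLike g) (x y : A) :
    inner ℂ g (A.prod x y) = inner ℂ g x * inner ℂ g y := by
  rw [← inner_comul, hg.2, inner_htmul]

theorem IsGroupLike.inner_self_ne {g : A} (hg : IsGroupLike g) : (inner ℂ g g : ℂ) ≠ 0 :=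
  inner_self_ne_zero.2 hg.1

/-- Group-like elements are orthogonal to the radical. -/
theorem IsGroupLike.mem_radical_orthogonal {g : A} (hg : IsGroupLike g) :
    g ∈ A.radicalᗮ := by
  have hker : IsMaximalModular (LinearMap.ker (innerSL ℂ g).toLinearMap) := by
    refine ⟨⟨(inner ℂ g g : ℂ)⁻¹ • g, fun x => ?_⟩, ⟨fun x y hy => ?_, fun h => ?_⟩, ?_⟩
    · simp [smul_prod, inner_sub_right, inner_smul_right, hg.inner_prod, hg.1]
    · simp only [LinearMap.mem_ker, ContinuousLinearMap.coe_coe, innerSL_apply_apply] at hy ⊢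
      rw [hg.inner_prod, hy, mul_zero]
    · have : g ∈ LinearMap.ker (innerSL ℂ g).toLinearMap := h ▸ Submodule.mem_top
      exact hg.inner_self_ne (by simpa using this)
    · rintro K ⟨-, hK⟩ hle z hz
      by_contra hzk
      have hz0 : (inner ℂ g z : ℂ) ≠ 0 := by simpa using hzk
      refine hK (eq_top_iff.2 fun x _ => ?_)
      have : x - ((inner ℂ g x : ℂ) / inner ℂ g z) • z ∈ K := by
        apply hle
        simp [inner_sub_right, inner_smul_right, hz0]
      simpa using K.add_mem this (K.smul_mem ((inner ℂ g x : ℂ) / inner ℂ g z) hz)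
  refine (Submodule.mem_orthogonal _ _).2 fun x hx => ?_
  have : x ∈ LinearMap.ker (innerSL ℂ g).toLinearMap := (Submodule.mem_sInf.1 hx) _ hker
  exact inner_eq_zero_symm.1 (by simpa using this)

/-- An element with zero square lies in the radical. -/
theorem mem_radical_of_sq {x : A} (hx : A.prod x x = 0) : x ∈ A.radical := by
  refine Submodule.mem_sInf.2 fun M hM => ?_
  obtain ⟨⟨e, he⟩, ⟨hMi, hMt⟩, hmax⟩ := hM
  by_contra hxM
  let K : Submodule ℂ A := M ⊔ (ℂ ∙ x) ⊔ LinearMap.range (A.mulOp x).toLinearMap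
  have hxK : x ∈ K := Submodule.mem_sup_left
    (Submodule.mem_sup_right (Submodule.mem_span_singleton_self x))
  have hmem : ∀ z, z ∈ K ↔ ∃ m ∈ M, ∃ c : ℂ, ∃ b : A, m + c • x + A.prod x b = z := by
    intro z
    simp only [K, Submodule.mem_sup, Submodule.mem_span_singleton, LinearMap.mem_range]
    constructor
    · rintro ⟨_, ⟨m, hm, _, ⟨c, rfl⟩, rfl⟩, _, ⟨b, rfl⟩, rfl⟩
      exact ⟨m, hm, c, b, rfl⟩
    · rintro ⟨m, hm, c, b, rfl⟩
      exact ⟨_, ⟨m, hm, _, ⟨c, rfl⟩, rfl⟩, _, ⟨b, rfl⟩, rfl⟩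
  have hKi : IsIdeal K := by
    intro a z hz
    obtain ⟨m, hm, c, b, rfl⟩ := (hmem z).1 hz
    refine (hmem _).2 ⟨A.prod a m, hMi _ _ hm, 0, c • a + A.prod a b, ?_⟩
    rw [prod_add, prod_add, prod_add, prod_smul, prod_smul, zero_smul, add_zero, prod_comm x a,
      ← prod_assoc, prod_comm x a, prod_assoc, add_assoc]
  have hKt : K = ⊤ := by
    by_contra h
    exact hxM (hmax ⟨hKi, h⟩ (le_sup_left.trans le_sup_left) hxK)
  obtain ⟨m, hm, c, b, hz⟩ := (hmem e).1 (hKt ▸ Submodule.mem_top)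
  have hxe : A.prod x (c • x + A.prod x b) = 0 := by
    rw [prod_add, prod_smul, hx, ← prod_assoc, hx, zero_prod, smul_zero, add_zero]
  have hse : A.prod (c • x + A.prod x b) (c • x + A.prod x b) = 0 := by
    rw [add_prod, smul_prod, hxe, smul_zero, prod_assoc, prod_comm b, ← prod_assoc, hxe,
      zero_prod, add_zero]
  have hee : A.prod e e ∈ M := by
    rw [add_assoc] at hz
    rw [← hz, add_prod, prod_add _ m, prod_add _ m, hse, add_zero, prod_comm m (c • x + _)]
    exact M.add_mem (M.add_mem (hMi _ _ hm) (hMi _ _ hm)) (hMi _ _ hm)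
  have heM : e ∈ M := by simpa using M.add_mem (he e) hee
  refine hMt (eq_top_iff.2 fun y _ => ?_)
  have : A.prod e y ∈ M := by rw [prod_comm]; exact hMi _ _ heM
  simpa using M.add_mem (he y) this

/-- An elementwise form of the first half of the Frobenius condition. -/
theorem IsFrobenius.comul_prod (h : A.IsFrobenius) (x y : A) :
    A.comul (A.prod x y) = hmap (A.mulOp x) (ContinuousLinearMap.id ℂ A) (A.comul y) := by
  have h1 := congrArg (fun φ => φ (htmul x y)) h.1
  have h2 : hmap A.mul (ContinuousLinearMap.id ℂ A) ∘L
      ((hassoc A A A).symm : _ →L[ℂ] _) ∘L htmulL x =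
      hmap (A.mulOp x) (ContinuousLinearMap.id ℂ A) :=
    htensor_ext fun y z => by simp [htmulL_apply, mulOp]
  rw [← h2]
  simpa [htmulL_apply, prod] using h1

/-- An elementwise form of the second half of the Frobenius condition. -/
theorem IsFrobenius.comul_prod' (h : A.IsFrobenius) (x y : A) :
    A.comul (A.prod x y) = hmap (ContinuousLinearMap.id ℂ A) (A.mulOp y) (A.comul x) := by
  have h1 := congrArg (fun φ => φ (htmul x y)) h.2
  have h2 : hmap (ContinuousLinearMap.id ℂ A) A.mul ∘L
      (hassoc A A A : _ →L[ℂ] _) ∘L htmulL.flip y =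
      hmap (ContinuousLinearMap.id ℂ A) (A.mulOp y) :=
    htensor_ext fun z w => by
      have := prod_comm w y
      simp only [prod] at this
      simp [htmulL_apply, mulOp, this]
  rw [← h2]
  simpa [htmulL_apply, prod] using h1

theorem IsGroupLike.prod_eq (h : A.IsFrobenius) {g : A} (hg : IsGroupLike g) (u : A) :
    A.prod u g = (inner ℂ g u : ℂ) • g := by
  have h1 : htmul (A.prod u g) g = htmul g (A.prod u g) := by
    have e1 := h.comul_prod u g
    have e2 := h.comul_prod' g u
    rw [prod_comm g u, e1, hg.2] at e2
    simpa [mulOp_apply] using e2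
  refine ext_inner_left ℂ fun v => ?_
  have h2 := congrArg (fun t => inner ℂ (htmul g v) t) h1
  simp only [inner_htmul, hg.inner_prod] at h2
  rw [inner_smul_right]
  have h3 := hg.inner_self_ne
  apply mul_left_cancel₀ h3
  rw [← h2]; ring

theorem IsGroupLike.norm_le (h : A.IsFrobenius) {g : A} (hg : IsGroupLike g) :
    ‖g‖ ≤ ‖A.mul‖ := by
  have h1 := norm_prod_le g g
  have h0 : 0 < ‖g‖ := norm_pos_iff.2 hg.1
  rw [hg.prod_eq h, norm_smul, inner_self_eq_norm_sq_to_K] at h1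
  simp only [norm_pow, Complex.coe_algebraMap, Complex.norm_real, norm_norm] at h1
  have : (‖g‖ * ‖g‖) * ‖g‖ ≤ (‖g‖ * ‖g‖) * ‖A.mul‖ := by nlinarith
  exact le_of_mul_le_mul_left this (by positivity)

theorem IsGroupLike.inner_eq_zero (h : A.IsFrobenius) {g k : A} (hg : IsGroupLike g)
    (hk : IsGroupLike k) (hne : g ≠ k) : (inner ℂ g k : ℂ) = 0 := by
  by_contra h0
  have h0' : (inner ℂ k g : ℂ) ≠ 0 := fun h' => h0 (inner_eq_zero_symm.1 h')
  have e : (inner ℂ g k : ℂ) • g = (inner ℂ k g : ℂ) • k := by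
    rw [← hg.prod_eq h k, ← hk.prod_eq h g, prod_comm]
  have e1 : (inner ℂ g g : ℂ) = inner ℂ k g := by
    have := congrArg (fun t => (inner ℂ g t : ℂ)) e
    simp only [inner_smul_right] at this
    exact mul_left_cancel₀ h0 (by rw [this]; ring)
  have e2 : (inner ℂ k k : ℂ) = inner ℂ g k := by
    have := congrArg (fun t => (inner ℂ k t : ℂ)) e
    simp only [inner_smul_right] at this
    exact mul_left_cancel₀ h0' (by rw [← this]; ring)
  have e3 : (inner ℂ g k : ℂ) = inner ℂ k g := by
    rw [← inner_conj_symm, ← e1, inner_self_conj]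
  apply hne
  rw [← sub_eq_zero, ← inner_self_eq_zero (𝕜 := ℂ), inner_sub_left, inner_sub_right,
    inner_sub_right, e1, e2, e3]
  ring

theorem IsGroupLike.eq_of_span (h : A.IsFrobenius) {g k : A} (hg : IsGroupLike g)
    (hk : IsGroupLike k) (hs : (ℂ ∙ g) = (ℂ ∙ k)) : g = k := by
  by_contra hne
  have h1 : g ∈ (ℂ ∙ k) := hs ▸ Submodule.mem_span_singleton_self g
  obtain ⟨c, rfl⟩ := Submodule.mem_span_singleton.1 h1
  have h2 := hk.inner_eq_zero h hg (Ne.symm hne)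
  rw [inner_smul_right] at h2
  rcases mul_eq_zero.1 h2 with hc | hc
  · exact hg.1 (by rw [hc, zero_smul])
  · exact hk.inner_self_ne hc

theorem IsGroupLike.isMinimalIdeal (h : A.IsFrobenius) {g : A} (hg : IsGroupLike g) :
    IsMinimalIdeal (ℂ ∙ g) := by
  refine ⟨⟨fun x y hy => ?_, ?_⟩, fun K hK hle => ?_⟩
  · obtain ⟨c, rfl⟩ := Submodule.mem_span_singleton.1 hy
    rw [prod_smul, hg.prod_eq h]
    exact Submodule.smul_mem _ _ (Submodule.smul_mem _ _ (Submodule.mem_span_singleton_self g))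
  · simpa using hg.1
  · obtain ⟨x, hx, hx0⟩ := (Submodule.ne_bot_iff K).1 hK.2
    obtain ⟨c, rfl⟩ := Submodule.mem_span_singleton.1 (hle hx)
    have hc : c ≠ 0 := fun h' => hx0 (by rw [h', zero_smul])
    refine (Submodule.span_singleton_le_iff_mem _ _).2 ?_
    simpa [smul_smul, hc] using K.smul_mem c⁻¹ hx

/-- An idempotent whose line is an ideal is proportional to a group-like element. -/
theorem exists_groupLike_of_idem (h : A.IsFrobenius) {e : A} (he0 : e ≠ 0)
    (he : A.prod e e = e) (hI : IsIdeal (ℂ ∙ e)) :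
    ∃ g : A, IsGroupLike g ∧ (ℂ ∙ e) = (ℂ ∙ g) := by
  have hin : (inner ℂ e e : ℂ) ≠ 0 := inner_self_ne_zero.2 he0
  have h1 : A.comul e = hmap (A.mulOp e) (A.mulOp e) (A.comul e) := by
    have e1 := h.comul_prod e e
    have e2 := h.comul_prod' e e
    have e3 : hmap (A.mulOp e) (A.mulOp e) =
        hmap (A.mulOp e) (ContinuousLinearMap.id ℂ A) ∘L
          hmap (ContinuousLinearMap.id ℂ A) (A.mulOp e) := htensor_ext fun x y => by simp
    rw [he] at e1 e2
    rw [e3, ContinuousLinearMap.comp_apply, ← e2, ← e1]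
  have h2 : ∀ t, hmap (A.mulOp e) (A.mulOp e) t ∈ (ℂ ∙ (htmul e e : HTensor A A)) := by
    refine htensor_mem (Submodule.comap (hmap (A.mulOp e) (A.mulOp e)).toLinearMap
      (ℂ ∙ (htmul e e : HTensor A A)))
      ((Submodule.closed_of_finiteDimensional (ℂ ∙ (htmul e e : HTensor A A))).preimage (ContinuousLinearMap.continuous _)) ?_
    intro x y
    have hl : ∀ x, A.mulOp e x ∈ (ℂ ∙ e) := fun x => by
      rw [mulOp_apply, prod_comm]; exact hI _ _ (Submodule.mem_span_singleton_self e)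
    obtain ⟨a, ha⟩ := Submodule.mem_span_singleton.1 (hl x)
    obtain ⟨b, hb⟩ := Submodule.mem_span_singleton.1 (hl y)
    refine Submodule.mem_span_singleton.2 ⟨b * a, ?_⟩
    simp [← ha, ← hb, htmul_smul, smul_htmul, smul_smul]
  obtain ⟨c, hc⟩ := Submodule.mem_span_singleton.1 (h2 (A.comul e))
  rw [← h1] at hc
  have h3 : c * (inner ℂ e e : ℂ) = 1 := by
    have h4 := congrArg (fun t => (inner ℂ (htmul e e) t : ℂ)) hc
    have h5 : (inner ℂ (htmul e e) (A.comul e) : ℂ) = inner ℂ e e := by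
      rw [← inner_conj_symm, inner_comul, he, inner_self_conj]
    simp only [inner_smul_right, inner_htmul, h5] at h4
    apply mul_right_cancel₀ hin
    rw [one_mul, mul_assoc, h4]
  have hc0 : c ≠ 0 := fun h' => by simp [h'] at h3
  refine ⟨c • e, ⟨smul_ne_zero hc0 he0, ?_⟩, ?_⟩
  · rw [map_smul, ← hc, htmul_smul, smul_htmul]
  · exact (Submodule.span_singleton_smul_eq (IsUnit.mk0 c hc0) e).symm

/-- A minimal ideal that is orthogonal to the radical is spanned by a group-like element. -/
theorem exists_groupLike (h : A.IsFrobenius) {I : Submodule ℂ A} (hI : IsMinimalIdeal I)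
    (hIr : I ≤ A.radicalᗮ) : ∃ g : A, IsGroupLike g ∧ I = (ℂ ∙ g) := by
  obtain ⟨⟨hid, hbot⟩, hmin⟩ := hI
  have hsq : ∀ x ∈ I, x ≠ 0 → A.prod x x ≠ 0 := by
    intro x hx hx0 hxx
    have := (Submodule.mem_orthogonal _ _).1 (hIr hx) x (mem_radical_of_sq hxx)
    exact hx0 (inner_self_eq_zero.1 this)
  have hsurj : ∀ x ∈ I, x ≠ 0 → ∀ z ∈ I, ∃ y ∈ I, A.prod x y = z := by
    intro x hx hx0 z hz
    have hK : I ≤ I.map (A.mulOp x).toLinearMap := by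
      refine hmin ⟨?_, ?_⟩ ?_
      · rintro a _ ⟨y, hy, rfl⟩
        exact ⟨A.prod a y, hid _ _ hy, by
          change A.prod x (A.prod a y) = A.prod a (A.prod x y)
          rw [← prod_assoc, prod_comm x a, prod_assoc]⟩
      · exact (Submodule.ne_bot_iff _).2 ⟨_, ⟨x, hx, rfl⟩, hsq x hx hx0⟩
      · rintro _ ⟨y, hy, rfl⟩
        exact hid _ _ hy
    exact hK hz
  have hinj : ∀ x ∈ I, x ≠ 0 → ∀ y ∈ I, A.prod x y = 0 → y = 0 := by
    intro x hx hx0 y hy hxy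
    by_contra hy0
    obtain ⟨w, hw, hwx⟩ := hsurj y hy hy0 x hx
    apply hsq x hx hx0
    conv_lhs => rw [← hwx, prod_comm, hwx]
    rw [← hwx, ← prod_assoc, hwx, hxy, zero_prod]
  obtain ⟨x, hx, hx0⟩ := (Submodule.ne_bot_iff I).1 hbot
  obtain ⟨e, he, hxe⟩ := hsurj x hx hx0 x hx
  have hunit : ∀ y ∈ I, A.prod e y = y := by
    intro y hy
    have := hinj x hx hx0 (A.prod e y - y) (I.sub_mem (hid _ _ hy) hy) (by
      rw [prod_sub, ← prod_assoc, hxe, sub_self])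
    exact sub_eq_zero.1 this
  have he0 : e ≠ 0 := fun h' => hx0 (by rw [← hxe, h', prod_zero])
  have hclosed : IsClosed (I : Set A) := by
    have : (I : Set A) = {y | A.mulOp e y = y} := by
      ext y
      refine ⟨fun hy => hunit y hy, fun hy => ?_⟩
      have hy' : A.prod e y = y := hy
      rw [SetLike.mem_coe, ← hy', prod_comm]
      exact hid _ _ he
    rw [this]
    exact isClosed_eq (A.mulOp e).continuous continuous_id
  have : CompleteSpace I := hclosed.completeSpace_coe
  have : Nontrivial I := ⟨⟨⟨e, he⟩, 0, fun h' => he0 (congrArg Subtype.val h')⟩⟩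
  let R : A → (I →L[ℂ] I) := fun z =>
    ((A.mulOp z) ∘L I.subtypeL).codRestrict I fun y => hid _ _ y.2
  have hR : ∀ z (y : I), ((R z y : I) : A) = A.prod z y := fun _ _ => rfl
  have hline : ∀ y ∈ I, ∃ c : ℂ, c • e = y := by
    intro y hy
    obtain ⟨c, hc⟩ := spectrum.nonempty (R y)
    refine ⟨c, ?_⟩
    by_contra hne
    obtain ⟨w, hw, hzw⟩ := hsurj (c • e - y) (I.sub_mem (I.smul_mem c he) hy)
      (sub_ne_zero.2 hne) e he
    apply hc
    have e1 : algebraMap ℂ (I →L[ℂ] I) c - R y = R (c • e - y) := by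
      ext t
      rw [hR, sub_prod, smul_prod, hunit _ t.2]
      rfl
    have e2 : R (c • e - y) * R w = 1 := by
      ext t
      change A.prod (c • e - y) (A.prod w t) = t
      rw [← prod_assoc, hzw, hunit _ t.2]
    have e3 : R w * R (c • e - y) = 1 := by
      ext t
      change A.prod w (A.prod (c • e - y) t) = t
      rw [← prod_assoc, prod_comm w, hzw, hunit _ t.2]
    rw [spectrum.mem_resolventSet_iff, e1]
    exact ⟨⟨_, _, e2, e3⟩, rfl⟩
  have hspan : I = (ℂ ∙ e) := by
    refine le_antisymm (fun y hy => Submodule.mem_span_singleton.2 (hline y hy))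
      ((Submodule.span_singleton_le_iff_mem _ _).2 he)
  obtain ⟨g, hg, hge⟩ := exists_groupLike_of_idem h he0 (hunit e he) (hspan ▸ hid)
  exact ⟨g, hg, hspan.trans hge⟩

/-- The adjoint of a morphism sends a group-like element to a group-like element or to zero. -/
theorem IsGroupLike.adjoint {B : HilbAlg.{u}} (f : A ⟶ B) {g : B} (hg : IsGroupLike g) :
    ContinuousLinearMap.adjoint (Hom.toCLM f) g = 0 ∨
      IsGroupLike (ContinuousLinearMap.adjoint (Hom.toCLM f) g) := by
  refine or_iff_not_imp_left.2 fun h0 => ⟨h0, htensor_ext_inner fun x y => ?_⟩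
  rw [inner_comul, ContinuousLinearMap.adjoint_inner_left, Hom.map_prod, hg.inner_prod,
    inner_htmul, ContinuousLinearMap.adjoint_inner_left, ContinuousLinearMap.adjoint_inner_left]

end HilbAlg

/-! ### Weighted pointed sets -/

/-- A pointed set with a weight function off the base point that is bounded below by some
positive constant. -/
structure WPSet : Type (u + 1) where
  carrier : Type u
  pt : carrier
  weight : {x : carrier // x ≠ pt} → ℝ
  exists_le : ∃ C : ℝ, 0 < C ∧ ∀ x, C ≤ weight x

namespace WPSet

/-- The points other than the base point. -/
abbrev Off (X : WPSet.{u}) : Type u := {x : X.carrier // x ≠ X.pt}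

theorem weight_pos (X : WPSet.{u}) (x : X.Off) : 0 < X.weight x := by
  obtain ⟨C, hC, h⟩ := X.exists_le
  exact hC.trans_le (h x)

/-- A base-point preserving map, with finite fibres off the base point, that is bounded with
respect to the weights. -/
@[ext]
structure Hom (X Y : WPSet.{u}) : Type u where
  toFun : X.carrier → Y.carrier
  map_pt : toFun X.pt = Y.pt
  finite_fiber : ∀ y, y ≠ Y.pt → (toFun ⁻¹' {y}).Finite
  exists_bound : ∃ M : ℝ, 0 ≤ M ∧ ∀ y : Y.Off,
    ∑ᶠ x ∈ {x : X.Off | toFun x = y}, X.weight x ≤ M * Y.weight y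

variable {X Y Z : WPSet.{u}}

/-- The weight bound of a morphism, for finite sets of points. -/
theorem Hom.exists_finset_bound (f : Hom X Y) : ∃ M : ℝ, 0 ≤ M ∧ ∀ (y : Y.Off)
    (s : Finset X.Off), (∀ x ∈ s, f.toFun x = y) → ∑ x ∈ s, X.weight x ≤ M * Y.weight y := by
  obtain ⟨M, hM, h⟩ := f.exists_bound
  refine ⟨M, hM, fun y s hs => le_trans ?_ (h y)⟩
  have hfin : {x : X.Off | f.toFun x = y}.Finite :=
    Set.Finite.of_finite_image ((f.finite_fiber y y.2).subset (by rintro _ ⟨x, hx, rfl⟩; exact hx))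
      Subtype.val_injective.injOn
  rw [finsum_mem_eq_finite_toFinset_sum _ hfin]
  exact Finset.sum_le_sum_of_subset_of_nonneg (fun x hx => by simpa using hs x hx)
    fun x _ _ => (X.weight_pos x).le

/-- A base-point preserving map that satisfies the weight bound for finite sets of points is a
morphism. -/
def Hom.ofFinset (f : X.carrier → Y.carrier) (hf : f X.pt = Y.pt)
    (hb : ∃ M : ℝ, 0 ≤ M ∧ ∀ (y : Y.Off) (s : Finset X.Off), (∀ x ∈ s, f x = y) →
      ∑ x ∈ s, X.weight x ≤ M * Y.weight y) : Hom X Y :=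
  have hfin : ∀ y : Y.Off, {x : X.Off | f x = y}.Finite := by
    intro y
    obtain ⟨M, -, h⟩ := hb
    obtain ⟨C, hC, hw⟩ := X.exists_le
    by_contra hinf
    obtain ⟨n, hn⟩ := exists_nat_gt (M * Y.weight y / C)
    obtain ⟨s, hs, hcard⟩ := Set.Infinite.exists_subset_card_eq hinf n
    have h1 := h y s fun x hx => hs hx
    have h2 : (n : ℝ) * C ≤ ∑ x ∈ s, X.weight x := by
      rw [← hcard, ← nsmul_eq_mul]
      exact Finset.card_nsmul_le_sum _ _ _ fun x _ => hw x
    rw [div_lt_iff₀ hC] at hn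
    linarith
  { toFun := f
    map_pt := hf
    finite_fiber := fun y hy => by
      refine ((hfin ⟨y, hy⟩).image Subtype.val).subset fun x hx => ?_
      have hx' : f x = y := hx
      exact ⟨⟨x, fun h => hy (by rw [← hx', h, hf])⟩, hx, rfl⟩
    exists_bound := by
      obtain ⟨M, hM, h⟩ := hb
      refine ⟨M, hM, fun y => ?_⟩
      rw [finsum_mem_eq_finite_toFinset_sum _ (hfin y)]
      exact h y _ fun x hx => by simpa using hx }

/-- The identity morphism. -/
def Hom.id (X : WPSet.{u}) : Hom X X :=
  Hom.ofFinset _root_.id rfl ⟨1, zero_le_one, fun y s hs => by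
    have hsub : s ⊆ {y} := fun x hx => by simpa using Subtype.ext (hs x hx)
    calc ∑ x ∈ s, X.weight x ≤ ∑ x ∈ {y}, X.weight x :=
          Finset.sum_le_sum_of_subset_of_nonneg hsub fun x _ _ => (X.weight_pos x).le
      _ = 1 * X.weight y := by simp⟩

/-- Composition of morphisms. -/
def Hom.comp (f : Hom X Y) (g : Hom Y Z) : Hom X Z :=
  Hom.ofFinset (g.toFun ∘ f.toFun) (by simp [f.map_pt, g.map_pt]) (by
    classical
    obtain ⟨M, hM, hf⟩ := f.exists_finset_bound
    obtain ⟨N, hN, hg⟩ := g.exists_finset_bound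
    refine ⟨M * N, mul_nonneg hM hN, fun z s hs => ?_⟩
    have hne : ∀ x ∈ s, f.toFun x ≠ Y.pt := fun x hx h => z.2 (by
      rw [← hs x hx, Function.comp_apply, h, g.map_pt])
    let t : Finset Y.Off := s.attach.image fun x => ⟨f.toFun x.1, hne x.1 x.2⟩
    have ht : ∀ y ∈ t, g.toFun y = z := by
      intro y hy
      obtain ⟨x, -, rfl⟩ := Finset.mem_image.1 hy
      exact hs x.1 x.2
    calc ∑ x ∈ s, X.weight x = ∑ y ∈ t, ∑ x ∈ s.filter (fun x : X.Off => f.toFun x = y), X.weight x := by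
          rw [← Finset.sum_attach]
          rw [← Finset.sum_fiberwise_of_maps_to (t := t)
            (g := fun x : s => (⟨f.toFun x.1, hne x.1 x.2⟩ : Y.Off))
            (fun x hx => Finset.mem_image_of_mem _ hx)]
          refine Finset.sum_congr rfl fun y _ => ?_
          rw [Finset.sum_filter, Finset.sum_filter, ← Finset.sum_attach s]
          refine Finset.sum_congr rfl fun x _ => ?_
          simp [Subtype.ext_iff]
      _ ≤ ∑ y ∈ t, M * Y.weight y := Finset.sum_le_sum fun y _ => hf y _ fun x hx => by
          simpa using (Finset.mem_filter.1 hx).2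
      _ = M * ∑ y ∈ t, Y.weight y := by rw [Finset.mul_sum]
      _ ≤ M * (N * Z.weight z) := mul_le_mul_of_nonneg_left (hg z t ht) hM
      _ = M * N * Z.weight z := by ring)

instance : Category WPSet.{u} where
  Hom := Hom
  id := Hom.id
  comp := Hom.comp

@[simp] theorem id_toFun (X : WPSet.{u}) : Hom.toFun (𝟙 X) = _root_.id := rfl

@[simp] theorem comp_toFun (f : X ⟶ Y) (g : Y ⟶ Z) :
    Hom.toFun (f ≫ g) = Hom.toFun g ∘ Hom.toFun f := rfl

theorem hom_ext {f g : X ⟶ Y} (h : ∀ x, Hom.toFun f x = Hom.toFun g x) : f = g :=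
  Hom.ext (funext h)

/-- The functor that forgets the weights. -/
def forgetWeight : WPSet.{u} ⥤ Pointed.{u} where
  obj X := ⟨X.carrier, X.pt⟩
  map f := ⟨Hom.toFun f, Hom.map_pt f⟩

end WPSet

/-! ### Hilbertian Frobenius semigroups -/

/-- The category of commutative Hilbertian Frobenius semigroups: the full subcategory of the
commutative Hilbertian algebras that satisfy the Frobenius condition. -/
abbrev FrobSem : Type (u + 1) :=
  ObjectProperty.FullSubcategory fun A : HilbAlg.{u} => A.IsFrobenius

/-- The category of semisimple commutative Hilbertian Frobenius semigroups. -/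
abbrev SemisimpleFrobSem : Type (u + 1) :=
  ObjectProperty.FullSubcategory fun A : FrobSem.{u} => A.obj.IsSemisimple

/-- The category of finite-dimensional semisimple commutative Hilbertian Frobenius semigroups. -/
abbrev FdSemisimpleFrobSem : Type (u + 1) :=
  ObjectProperty.FullSubcategory fun A : SemisimpleFrobSem.{u} =>
    FiniteDimensional ℂ A.obj.obj.carrier

/-- The category of finite pointed sets and base-point preserving maps. -/
abbrev FinPointed : Type (u + 1) :=
  ObjectProperty.FullSubcategory fun X : Pointed.{u} => Finite X

/-! ### The functor of minimal ideals -/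

namespace HilbAlg

variable (A : HilbAlg.{u})

/-- The minimal ideals contained in the orthogonal complement of the radical, with the zero ideal
added. -/
def MinIdeal : Type u :=
  {I : Submodule ℂ A // I = ⊥ ∨ (IsMinimalIdeal I ∧ I ≤ A.radicalᗮ)}

variable {A}

open Classical in
/-- The group-like generator of a minimal ideal (and `0` for the zero ideal). -/
def gen (I : Submodule ℂ A) : A :=
  if h : ∃ g : A, IsGroupLike g ∧ I = (ℂ ∙ g) then h.choose else 0

theorem gen_span (h : A.IsFrobenius) {g : A} (hg : IsGroupLike g) : gen (ℂ ∙ g) = g := by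
  have hex : ∃ k : A, IsGroupLike k ∧ (ℂ ∙ g) = (ℂ ∙ k) := ⟨g, hg, rfl⟩
  rw [gen, dif_pos hex]
  exact (hg.eq_of_span h hex.choose_spec.1 hex.choose_spec.2).symm

theorem gen_bot : gen (⊥ : Submodule ℂ A) = 0 := by
  rw [gen, dif_neg]
  rintro ⟨g, hg, h⟩
  exact hg.1 (Submodule.span_singleton_eq_bot.1 h.symm)

theorem MinIdeal.gen_spec (h : A.IsFrobenius) (I : A.MinIdeal) (hI : I.1 ≠ ⊥) :
    IsGroupLike (gen I.1) ∧ I.1 = (ℂ ∙ gen I.1) := by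
  obtain ⟨hm, hr⟩ := I.2.resolve_left hI
  have hex := exists_groupLike h hm hr
  rw [gen, dif_pos hex]
  exact hex.choose_spec

theorem MinIdeal.span_gen (h : A.IsFrobenius) (I : A.MinIdeal) : (ℂ ∙ gen I.1) = I.1 := by
  by_cases hI : I.1 = ⊥
  · rw [hI, gen_bot, Submodule.span_zero_singleton]
  · exact (I.gen_spec h hI).2.symm

theorem MinIdeal.gen_eq_zero_or (h : A.IsFrobenius) (I : A.MinIdeal) :
    gen I.1 = 0 ∨ IsGroupLike (gen I.1) := by
  by_cases hI : I.1 = ⊥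
  · left; rw [hI, gen_bot]
  · exact Or.inr (I.gen_spec h hI).1

/-- The line spanned by `g` when `g` is group-like or zero. -/
def lineOf (h : A.IsFrobenius) (g : A) (hg : g = 0 ∨ IsGroupLike g) : A.MinIdeal :=
  ⟨ℂ ∙ g, hg.imp (fun h0 => by rw [h0, Submodule.span_zero_singleton]) fun hg =>
    ⟨hg.isMinimalIdeal h, (Submodule.span_singleton_le_iff_mem _ _).2 hg.mem_radical_orthogonal⟩⟩

theorem adjoint_gen {B : HilbAlg.{u}} (f : A ⟶ B) (h : B.IsFrobenius) (J : B.MinIdeal) :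
    ContinuousLinearMap.adjoint (Hom.toCLM f) (gen J.1) = 0 ∨
      IsGroupLike (ContinuousLinearMap.adjoint (Hom.toCLM f) (gen J.1)) := by
  rcases J.gen_eq_zero_or h with h0 | h0
  · left; rw [h0, map_zero]
  · exact h0.adjoint f

theorem gen_lineOf (h : A.IsFrobenius) (g : A) (hg : g = 0 ∨ IsGroupLike g) :
    gen (lineOf h g hg).1 = g := by
  rcases hg with h0 | hg
  · subst h0
    change gen (ℂ ∙ (0 : A)) = 0
    rw [Submodule.span_zero_singleton, gen_bot]
  · exact gen_span h hg

end HilbAlg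

open HilbAlg in
/-- The weighted pointed set of a Hilbertian Frobenius semigroup: its minimal ideals (with `0` as
the base point), and the weight `‖g‖⁻²` of the ideal with group-like generator `g`. -/
def minObj (A : FrobSem.{u}) : WPSet.{u} where
  carrier := A.obj.MinIdeal
  pt := ⟨⊥, Or.inl rfl⟩
  weight I := 1 / ‖gen I.1.1‖ ^ 2
  exists_le := by
    refine ⟨1 / (‖A.obj.mul‖ + 1) ^ 2, by positivity, fun I => ?_⟩
    have hI : I.1.1 ≠ ⊥ := fun h => I.2 (Subtype.ext h)
    have hg := (I.1.gen_spec A.property hI).1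
    have h0 : 0 < ‖gen I.1.1‖ := norm_pos_iff.2 hg.1
    have h1 := hg.norm_le A.property
    gcongr
    linarith

theorem minObj_isGroupLike (A : FrobSem.{u}) (I : (minObj A).Off) :
    HilbAlg.IsGroupLike (HilbAlg.gen I.1.1) :=
  (I.1.gen_spec A.property fun h => I.2 (Subtype.ext h)).1

open HilbAlg in
/-- The map `J ↦ ℂ f†(g_J)` between sets of minimal ideals, `g_J` being the group-like generator
of `J`. -/
def minMap {A B : FrobSem.{u}} (f : A ⟶ B) : minObj B ⟶ minObj A :=
  WPSet.Hom.ofFinset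
    (fun J : B.obj.MinIdeal => lineOf A.property
      (ContinuousLinearMap.adjoint (Hom.toCLM f.hom) (gen J.1))
      (adjoint_gen f.hom B.property J))
    (by
      refine Subtype.ext ?_
      change (ℂ ∙ ContinuousLinearMap.adjoint (Hom.toCLM f.hom) (gen ⊥)) = ⊥
      rw [gen_bot, map_zero, Submodule.span_zero_singleton])
    (by
      classical
      refine ⟨‖Hom.toCLM f.hom‖ ^ 2, by positivity, fun I s hs => ?_⟩
      have hgI := minObj_isGroupLike A I
      set g : A.obj := gen I.1.1 with hg
      have hn : 0 < ‖g‖ := norm_pos_iff.2 hgI.1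
      have hadj : ∀ J ∈ s, ContinuousLinearMap.adjoint (Hom.toCLM f.hom) (gen J.1.1) = g := by
        intro J hJ
        rw [hg, ← hs J hJ]
        exact (gen_lineOf A.property _ _).symm
      let e : A.obj := ((‖g‖ ^ 2 : ℝ) : ℂ)⁻¹ • g
      have hge : (inner ℂ g e : ℂ) = 1 := by
        have h1 : ((‖g‖ : ℝ) : ℂ) ≠ 0 := by exact_mod_cast hn.ne'
        simp only [e, inner_smul_right, inner_self_eq_norm_sq_to_K]
        push_cast
        field_simp
        simp
      have hne : ‖e‖ ^ 2 = 1 / ‖g‖ ^ 2 := by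
        simp only [e, norm_smul, norm_inv, Complex.norm_real, norm_pow, norm_norm]
        field_simp
      let v : (minObj B).Off → B.obj := fun J => ((‖gen J.1.1‖ : ℝ) : ℂ)⁻¹ • gen J.1.1
      have hv : Orthonormal ℂ v := by
        refine ⟨fun J => ?_, fun J J' hJJ' => ?_⟩
        · have h0 : ‖gen J.1.1‖ ≠ 0 := norm_ne_zero_iff.2 (minObj_isGroupLike B J).1
          simp only [v, norm_smul, norm_inv, Complex.norm_real, norm_norm]
          field_simp
        · simp only [v, inner_smul_left, inner_smul_right]
          rw [(minObj_isGroupLike B J).inner_eq_zero B.property (minObj_isGroupLike B J')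
            fun h => hJJ' (Subtype.ext (Subtype.ext (by
              rw [← J.1.span_gen B.property, ← J'.1.span_gen B.property, h]))), mul_zero, mul_zero]
      calc ∑ J ∈ s, (minObj B).weight J
          = ∑ J ∈ s, ‖(inner ℂ (v J) (Hom.toCLM f.hom e) : ℂ)‖ ^ 2 := by
            refine Finset.sum_congr rfl fun J hJ => ?_
            have h1 : (inner ℂ (gen J.1.1) (Hom.toCLM f.hom e) : ℂ) = 1 := by
              rw [← ContinuousLinearMap.adjoint_inner_left, hadj J hJ, hge]
            simp only [v, inner_smul_left, h1]
            simp [minObj]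
        _ ≤ ‖Hom.toCLM f.hom e‖ ^ 2 := hv.sum_inner_products_le _
        _ ≤ (‖Hom.toCLM f.hom‖ * ‖e‖) ^ 2 := by
            gcongr; exact (Hom.toCLM f.hom).le_opNorm e
        _ = ‖Hom.toCLM f.hom‖ ^ 2 * (minObj A).weight I := by
            rw [mul_pow, hne]; rfl)

theorem minMap_val {A B : FrobSem.{u}} (f : A ⟶ B) (J : B.obj.MinIdeal) :
    (WPSet.Hom.toFun (minMap f) J : A.obj.MinIdeal).1 =
      (ℂ ∙ ContinuousLinearMap.adjoint (HilbAlg.Hom.toCLM f.hom) (HilbAlg.gen J.1)) := rfl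

theorem gen_minMap {A B : FrobSem.{u}} (f : A ⟶ B) (J : B.obj.MinIdeal) :
    HilbAlg.gen (WPSet.Hom.toFun (minMap f) J : A.obj.MinIdeal).1 =
      ContinuousLinearMap.adjoint (HilbAlg.Hom.toCLM f.hom) (HilbAlg.gen J.1) :=
  HilbAlg.gen_lineOf A.property _ (HilbAlg.adjoint_gen f.hom B.property J)

/-- The functor `Min_•`. -/
def minFunctor : FrobSem.{u} ⥤ WPSet.{u}ᵒᵖ where
  obj A := Opposite.op (minObj A)
  map f := (minMap f).op
  map_id A := by
    refine congrArg Quiver.Hom.op (WPSet.hom_ext fun J => Subtype.ext ?_)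
    refine (minMap_val _ J).trans ?_
    change (ℂ ∙ ContinuousLinearMap.adjoint (ContinuousLinearMap.id ℂ A.obj)
      (HilbAlg.gen (A := A.obj) J.1)) = _
    rw [ContinuousLinearMap.adjoint_id]
    exact HilbAlg.MinIdeal.span_gen A.property J
  map_comp {A B C} f g := by
    refine congrArg Quiver.Hom.op (WPSet.hom_ext fun J => Subtype.ext ?_)
    refine (minMap_val _ J).trans ?_
    refine Eq.trans ?_ (minMap_val f (WPSet.Hom.toFun (minMap g) J)).symm
    refine congrArg (fun v => (ℂ ∙ v)) ?_
    refine Eq.trans ?_ (congrArg (ContinuousLinearMap.adjoint (HilbAlg.Hom.toCLM f.hom))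
      (gen_minMap g J)).symm
    exact DFunLike.congr_fun (ContinuousLinearMap.adjoint_comp
      (HilbAlg.Hom.toCLM g.hom) (HilbAlg.Hom.toCLM f.hom)) _

/-! ### Weighted `ℓ²` spaces -/

/-- The functions on a weighted pointed set that vanish at the base point and are square-summable
with respect to the weight. -/
def ell2Submodule (X : WPSet.{u}) : Submodule ℂ (X.carrier → ℂ) where
  carrier := {v | v X.pt = 0 ∧ Summable fun x : X.Off => X.weight x * ‖v x‖ ^ 2}
  zero_mem' := ⟨rfl, by simp⟩
  add_mem' := by
    rintro a b ⟨ha0, ha⟩ ⟨hb0, hb⟩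
    refine ⟨by simp [ha0, hb0], ((ha.mul_left 2).add (hb.mul_left 2)).of_nonneg_of_le
      (fun x => mul_nonneg (X.weight_pos x).le (sq_nonneg _)) fun x => ?_⟩
    have h1 : ‖a x + b x‖ ^ 2 ≤ 2 * ‖a x‖ ^ 2 + 2 * ‖b x‖ ^ 2 := by
      have := norm_add_le (a x) (b x)
      nlinarith [sq_nonneg (‖a x‖ - ‖b x‖), norm_nonneg (a x + b x)]
    have h2 := mul_le_mul_of_nonneg_left h1 (X.weight_pos x).le
    simp only [Pi.add_apply]
    linarith
  smul_mem' := by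
    rintro c a ⟨ha0, ha⟩
    refine ⟨by simp [ha0], (ha.mul_left (‖c‖ ^ 2)).congr fun x => ?_⟩
    simp only [Pi.smul_apply, smul_eq_mul, norm_mul]
    ring

/-- The weighted space `ℓ²_•(X)`. -/
def Ell2 (X : WPSet.{u}) : Type u := ell2Submodule X

namespace Ell2

variable {X Y Z : WPSet.{u}}

instance : AddCommGroup (Ell2 X) := inferInstanceAs (AddCommGroup (ell2Submodule X))

instance : Module ℂ (Ell2 X) := inferInstanceAs (Module ℂ (ell2Submodule X))

instance : CoeFun (Ell2 X) fun _ => X.carrier → ℂ := ⟨fun v => v.1⟩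

@[ext] theorem ext {v w : Ell2 X} (h : ∀ x, v x = w x) : v = w := Subtype.ext (funext h)

@[simp] theorem pt_eq (v : Ell2 X) : v X.pt = 0 := v.2.1

theorem summable (v : Ell2 X) : Summable fun x : X.Off => X.weight x * ‖v x‖ ^ 2 := v.2.2

@[simp] theorem add_apply (v w : Ell2 X) (x : X.carrier) : (v + w) x = v x + w x := rfl

@[simp] theorem smul_apply (c : ℂ) (v : Ell2 X) (x : X.carrier) : (c • v) x = c * v x := rfl

@[simp] theorem zero_apply (x : X.carrier) : (0 : Ell2 X) x = 0 := rfl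

theorem ext_off {v w : Ell2 X} (h : ∀ x : X.Off, v x = w x) : v = w := by
  ext x
  by_cases hx : x = X.pt
  · rw [hx, pt_eq, pt_eq]
  · exact h ⟨x, hx⟩

open Classical in
/-- Rescaling identifies the weighted space with the unweighted space over the points other than
the base point. -/
def toLp (X : WPSet.{u}) : Ell2 X ≃ₗ[ℂ] lp (fun _ : X.Off => ℂ) 2 where
  toFun v := ⟨fun x => (Real.sqrt (X.weight x) : ℂ) * v x, by
    refine memℓp_gen ?_
    refine v.summable.congr fun x => ?_
    have h := Real.sq_sqrt (X.weight_pos x).le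
    simp only [norm_mul, Complex.norm_real, Real.norm_eq_abs, ENNReal.toReal_ofNat, Real.rpow_ofNat,
      mul_pow, sq_abs, h]⟩
  map_add' v w := by ext x; exact mul_add _ _ _
  map_smul' c v := by ext x; exact mul_left_comm _ _ _
  invFun f := ⟨fun x => if h : x = X.pt then 0 else
      ((Real.sqrt (X.weight ⟨x, h⟩) : ℂ))⁻¹ * f ⟨x, h⟩, by
    refine ⟨by simp, ?_⟩
    have hs := (lp.memℓp f).summable (by simp)
    refine hs.congr fun x => ?_
    have h := Real.sq_sqrt (X.weight_pos x).le
    have h' := X.weight_pos x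
    simp only [x.2, dif_neg, not_false_iff, norm_mul, norm_inv, Complex.norm_real,
      Real.norm_eq_abs, ENNReal.toReal_ofNat, Real.rpow_ofNat, mul_pow, inv_pow, sq_abs, h]
    field_simp⟩
  left_inv v := by
    refine ext_off fun x => ?_
    have h' : (Real.sqrt (X.weight x) : ℂ) ≠ 0 := by
      exact_mod_cast (Real.sqrt_pos.2 (X.weight_pos x)).ne'
    refine (dif_neg x.2).trans ?_
    change (Real.sqrt (X.weight x) : ℂ)⁻¹ * ((Real.sqrt (X.weight x) : ℂ) * v x) = v x
    field_simp
  right_inv f := by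
    ext x
    have h' : (Real.sqrt (X.weight x) : ℂ) ≠ 0 := by
      exact_mod_cast (Real.sqrt_pos.2 (X.weight_pos x)).ne'
    refine (congrArg (fun z => (Real.sqrt (X.weight x) : ℂ) * z) (dif_neg x.2)).trans ?_
    exact mul_inv_cancel_left₀ h' _

theorem toLp_apply (v : Ell2 X) (x : X.Off) :
    toLp X v x = (Real.sqrt (X.weight x) : ℂ) * v x := rfl

theorem inner_term (v w : Ell2 X) (x : X.Off) : inner ℂ (toLp X v x) (toLp X w x) =
    (X.weight x : ℂ) * (starRingEnd ℂ (v x) * w x) := by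
  have h : (X.weight x : ℂ) = (Real.sqrt (X.weight x) : ℂ) * (Real.sqrt (X.weight x) : ℂ) := by
    exact_mod_cast (Real.mul_self_sqrt (X.weight_pos x).le).symm
  rw [toLp_apply, toLp_apply, h, RCLike.inner_apply]
  simp only [map_mul, Complex.conj_ofReal]
  ring

theorem toLp_inner (v w : Ell2 X) : inner ℂ (toLp X v) (toLp X w) =
    ∑' x : X.Off, (X.weight x : ℂ) * (starRingEnd ℂ (v x) * w x) := by
  rw [lp.inner_eq_tsum]
  exact tsum_congr fun x => inner_term v w x

instance : NormedAddCommGroup (Ell2 X) :=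
  NormedAddCommGroup.induced (Ell2 X) (lp (fun _ : X.Off => ℂ) 2) (toLp X) (toLp X).injective

theorem norm_toLp (v : Ell2 X) : ‖toLp X v‖ = ‖v‖ := rfl

instance : NormedSpace ℂ (Ell2 X) :=
  NormedSpace.induced ℂ (Ell2 X) (lp (fun _ : X.Off => ℂ) 2) (toLp X)

/-- The inner product `∑ α(x) conj(v(x)) w(x)`. -/
instance : InnerProductSpace ℂ (Ell2 X) where
  inner v w := ∑' x : X.Off, (X.weight x : ℂ) * (starRingEnd ℂ (v x) * w x)
  norm_sq_eq_re_inner v := by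
    rw [← toLp_inner, ← norm_toLp, inner_self_eq_norm_sq]
  conj_inner_symm v w := by
    rw [← toLp_inner, ← toLp_inner, inner_conj_symm]
  add_left u v w := by
    rw [← toLp_inner, ← toLp_inner, ← toLp_inner, map_add, inner_add_left]
  smul_left v w c := by
    rw [← toLp_inner, ← toLp_inner, map_smul, inner_smul_left]

theorem inner_eq (v w : Ell2 X) :
    inner ℂ v w = ∑' x : X.Off, (X.weight x : ℂ) * (starRingEnd ℂ (v x) * w x) := rfl

/-- The rescaling as a linear isometric equivalence. -/
def toLpₗᵢ (X : WPSet.{u}) : Ell2 X ≃ₗᵢ[ℂ] lp (fun _ : X.Off => ℂ) 2 where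
  __ := toLp X
  norm_map' := norm_toLp

instance : CompleteSpace (Ell2 X) :=
  (toLpₗᵢ X).toIsometryEquiv.completeSpace_iff.2 inferInstance

theorem hasSum_norm_sq (v : Ell2 X) :
    HasSum (fun x : X.Off => X.weight x * ‖v x‖ ^ 2) (‖v‖ ^ 2) := by
  have h := lp.hasSum_norm (p := 2) (by simp) (toLp X v)
  rw [norm_toLp] at h
  simp only [ENNReal.toReal_ofNat, Real.rpow_ofNat] at h
  convert! h using 2 with x
  rw [toLp_apply, norm_mul, mul_pow, Complex.norm_real, Real.norm_eq_abs, sq_abs,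
    Real.sq_sqrt (X.weight_pos x).le]

theorem weight_mul_le (v : Ell2 X) (x : X.Off) : X.weight x * ‖v x‖ ^ 2 ≤ ‖v‖ ^ 2 :=
  le_hasSum (hasSum_norm_sq v) x fun y _ => mul_nonneg (X.weight_pos y).le (sq_nonneg _)

theorem norm_sq_le {v : Ell2 X} {c : ℝ}
    (h : ∀ s : Finset X.Off, ∑ x ∈ s, X.weight x * ‖v x‖ ^ 2 ≤ c) : ‖v‖ ^ 2 ≤ c :=
  hasSum_le_of_sum_le (hasSum_norm_sq v) h

open Classical in
/-- The indicator function of a point other than the base point. -/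
def single (x : X.Off) : Ell2 X :=
  ⟨Pi.single x.1 1, by simp [x.2.symm], by
    refine summable_of_ne_finset_zero (s := {x}) fun y hy => ?_
    have : y.1 ≠ x.1 := fun h => hy (by simpa using Subtype.ext h)
    simp [this]⟩

open Classical in
theorem single_apply (x : X.Off) (y : X.carrier) :
    single x y = if y = x then 1 else 0 := by
  change (Pi.single x.1 1 : X.carrier → ℂ) y = _
  rw [Pi.single_apply]

theorem inner_single (x : X.Off) (v : Ell2 X) :
    inner ℂ (single x) v = (X.weight x : ℂ) * v x := by
  classical
  rw [inner_eq, tsum_eq_single x]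
  · simp [single_apply]
  · intro y hy
    have : y.1 ≠ x.1 := fun h => hy (Subtype.ext h)
    simp [single_apply, this]

/-- Bounded maps on the weighted space are determined by their values at the indicator
functions. -/
theorem clm_ext {E : Type*} [NormedAddCommGroup E] [NormedSpace ℂ E] {f g : Ell2 X →L[ℂ] E}
    (h : ∀ x, f (single x) = g (single x)) : f = g := by
  let S : Submodule ℂ (Ell2 X) := LinearMap.eqLocus (f : Ell2 X →ₗ[ℂ] E) g
  have hS : IsClosed (S : Set (Ell2 X)) := isClosed_eq f.continuous g.continuous
  have : CompleteSpace S := hS.completeSpace_coe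
  have htop : S = ⊤ := by
    rw [← Submodule.orthogonal_eq_bot_iff, Submodule.eq_bot_iff]
    intro v hv
    refine ext_off fun x => ?_
    have := (Submodule.mem_orthogonal _ _).1 hv (single x) (h x)
    rw [inner_single] at this
    have hw : (X.weight x : ℂ) ≠ 0 := by exact_mod_cast (X.weight_pos x).ne'
    simpa [hw] using this
  ext v
  exact (htop ▸ Submodule.mem_top : v ∈ S)

/-- The pointwise product. -/
def pmul (v w : Ell2 X) : Ell2 X :=
  ⟨fun x => v x * w x, by simp, by
    obtain ⟨C, hC, hX⟩ := X.exists_le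
    refine (v.summable.mul_right (‖w‖ ^ 2 / C)).of_nonneg_of_le
      (fun x => mul_nonneg (X.weight_pos x).le (sq_nonneg _)) fun x => ?_
    have h1 : ‖w x‖ ^ 2 ≤ ‖w‖ ^ 2 / C := by
      rw [le_div_iff₀ hC]
      have := weight_mul_le w x
      nlinarith [hX x, sq_nonneg ‖w x‖]
    rw [norm_mul, mul_pow, ← mul_assoc]
    exact mul_le_mul_of_nonneg_left h1 (mul_nonneg (X.weight_pos x).le (sq_nonneg _))⟩

@[simp] theorem pmul_apply (v w : Ell2 X) (x : X.carrier) : pmul v w x = v x * w x := rfl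

/-- The pointwise product as a linear map on the algebraic tensor product. -/
def mulAlg (X : WPSet.{u}) : Ell2 X ⊗[ℂ] Ell2 X →ₗ[ℂ] Ell2 X :=
  TensorProduct.lift (LinearMap.mk₂ ℂ pmul
    (fun v v' w => by ext x; simp [add_mul])
    (fun c v w => by ext x; simp [mul_assoc])
    (fun v w w' => by ext x; simp [mul_add])
    (fun c v w => by ext x; simp [mul_left_comm]))

@[simp] theorem mulAlg_tmul (v w : Ell2 X) : mulAlg X (v ⊗ₜ w) = pmul v w := rfl

theorem inner_single_tmul (x : X.Off) (t : Ell2 X ⊗[ℂ] Ell2 X) :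
    inner ℂ (single x ⊗ₜ[ℂ] single x) t = (X.weight x : ℂ) ^ 2 * mulAlg X t x := by
  induction t using TensorProduct.induction_on with
  | zero => simp
  | tmul v w => simp [inner_single]; ring
  | add s t hs ht => rw [inner_add_right, hs, ht, map_add, add_apply]; ring

theorem inner_smul_tmul (c : ℂ) (s t : Ell2 X ⊗[ℂ] Ell2 X) :
    inner ℂ (c • s) t = starRingEnd ℂ c * inner ℂ s t :=
  inner_smul_left s t c

theorem inner_smul_tmul_right (c : ℂ) (s t : Ell2 X ⊗[ℂ] Ell2 X) :
    inner ℂ s (c • t) = c * inner ℂ s t :=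
  inner_smul_right s t c

theorem exists_norm_mulAlg_le (X : WPSet.{u}) : ∃ C : ℝ, ∀ t, ‖mulAlg X t‖ ≤ C * ‖t‖ := by
  obtain ⟨C, hC, hX⟩ := X.exists_le
  refine ⟨Real.sqrt (1 / C), fun t => ?_⟩
  have hv : Orthonormal ℂ fun x : X.Off =>
      ((X.weight x : ℂ))⁻¹ • (single x ⊗ₜ[ℂ] single x) := by
    classical
    rw [orthonormal_iff_ite]
    intro x y
    have hx : (X.weight x : ℂ) ≠ 0 := by exact_mod_cast (X.weight_pos x).ne'
    rw [inner_smul_tmul, inner_smul_tmul_right, TensorProduct.inner_tmul, inner_single,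
      single_apply]
    by_cases h : x = y
    · subst h
      simp
      field_simp
    · have h' : (x : X.carrier) ≠ y := fun h' => h (Subtype.ext h')
      simp [h, h']
  have hb : ‖mulAlg X t‖ ^ 2 ≤ (1 / C) * ‖t‖ ^ 2 := by
    refine norm_sq_le fun s => ?_
    calc ∑ x ∈ s, X.weight x * ‖mulAlg X t x‖ ^ 2
        ≤ ∑ x ∈ s, (1 / C) * ‖(inner ℂ ((X.weight x : ℂ)⁻¹ • (single x ⊗ₜ[ℂ] single x)) t : ℂ)‖ ^ 2 := by
          refine Finset.sum_le_sum fun x _ => ?_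
          have hx := X.weight_pos x
          rw [inner_smul_tmul, inner_single_tmul]
          simp only [map_inv₀, Complex.conj_ofReal, norm_mul, norm_inv, norm_pow, Complex.norm_real,
            Real.norm_eq_abs, abs_of_pos hx]
          have e : (1 / C) * ((X.weight x)⁻¹ * (X.weight x ^ 2 * ‖mulAlg X t x‖)) ^ 2 =
              (X.weight x * ‖mulAlg X t x‖ ^ 2) * (X.weight x / C) := by
            field_simp
          rw [e]
          refine le_mul_of_one_le_right (mul_nonneg hx.le (sq_nonneg _)) ?_
          rw [one_le_div hC]
          exact hX x
      _ = (1 / C) * ∑ x ∈ s, ‖(inner ℂ ((X.weight x : ℂ)⁻¹ • (single x ⊗ₜ[ℂ] single x)) t : ℂ)‖ ^ 2 := by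
          rw [Finset.mul_sum]
      _ ≤ (1 / C) * ‖t‖ ^ 2 :=
          mul_le_mul_of_nonneg_left (hv.sum_inner_products_le t) (by positivity)
  refine (sq_le_sq₀ (norm_nonneg _) (by positivity)).1 ?_
  rw [mul_pow, Real.sq_sqrt (by positivity)]
  exact hb

/-- The multiplication on the Hilbertian tensor product, `v ⊗ w ↦ v w` (pointwise product). -/
def mul (X : WPSet.{u}) : HTensor (Ell2 X) (Ell2 X) →L[ℂ] Ell2 X :=
  ((mulAlg X).mkContinuousOfExistsBound (exists_norm_mulAlg_le X)).fromCompletion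

@[simp] theorem mul_htmul (v w : Ell2 X) : mul X (htmul v w) = pmul v w := by
  rw [mul, htmul, ContinuousLinearMap.fromCompletion_apply_coe]
  rfl

theorem pmul_single (v : Ell2 X) (x : X.Off) : pmul v (single x) = v x • single x := by
  classical
  ext y
  rw [pmul_apply, smul_apply, single_apply]
  split_ifs with h
  · rw [h]
  · simp

theorem pmul_comm (v w : Ell2 X) : pmul v w = pmul w v := by
  ext x; simp [mul_comm]

theorem adjoint_mul_single (x : X.Off) : ContinuousLinearMap.adjoint (mul X) (single x) =
    (X.weight x : ℂ)⁻¹ • htmul (single x) (single x) := by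
  refine htensor_ext_inner fun v w => ?_
  have hx : (X.weight x : ℂ) ≠ 0 := by exact_mod_cast (X.weight_pos x).ne'
  rw [ContinuousLinearMap.adjoint_inner_left, mul_htmul, inner_smul_left, inner_htmul,
    inner_single, inner_single, inner_single, pmul_apply]
  simp only [map_inv₀, Complex.conj_ofReal]
  field_simp

theorem frobenius_left (X : WPSet.{u}) : ContinuousLinearMap.adjoint (mul X) ∘L mul X =
    hmap (mul X) (ContinuousLinearMap.id ℂ (Ell2 X)) ∘L
      ((hassoc (Ell2 X) (Ell2 X) (Ell2 X)).symm : _ →L[ℂ] _) ∘L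
        hmap (ContinuousLinearMap.id ℂ (Ell2 X)) (ContinuousLinearMap.adjoint (mul X)) := by
  refine htensor_ext fun v w => ?_
  refine DFunLike.congr_fun (f := (ContinuousLinearMap.adjoint (mul X) ∘L mul X) ∘L htmulL v)
    (g := (hmap (mul X) (ContinuousLinearMap.id ℂ (Ell2 X)) ∘L
      ((hassoc (Ell2 X) (Ell2 X) (Ell2 X)).symm : _ →L[ℂ] _) ∘L
        hmap (ContinuousLinearMap.id ℂ (Ell2 X)) (ContinuousLinearMap.adjoint (mul X))) ∘L
          htmulL v) (clm_ext fun x => ?_) w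
  simp [htmulL_apply, pmul_single, adjoint_mul_single, htmul_smul, smul_htmul, smul_smul,
    mul_comm]

theorem frobenius_right (X : WPSet.{u}) : ContinuousLinearMap.adjoint (mul X) ∘L mul X =
    hmap (ContinuousLinearMap.id ℂ (Ell2 X)) (mul X) ∘L
      (hassoc (Ell2 X) (Ell2 X) (Ell2 X) : _ →L[ℂ] _) ∘L
        hmap (ContinuousLinearMap.adjoint (mul X)) (ContinuousLinearMap.id ℂ (Ell2 X)) := by
  refine htensor_ext fun v w => ?_
  refine DFunLike.congr_fun (f := (ContinuousLinearMap.adjoint (mul X) ∘L mul X) ∘L htmulL.flip w)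
    (g := (hmap (ContinuousLinearMap.id ℂ (Ell2 X)) (mul X) ∘L
      (hassoc (Ell2 X) (Ell2 X) (Ell2 X) : _ →L[ℂ] _) ∘L
        hmap (ContinuousLinearMap.adjoint (mul X)) (ContinuousLinearMap.id ℂ (Ell2 X))) ∘L
          htmulL.flip w) (clm_ext fun x => ?_) v
  simp [htmulL_apply, pmul_single, pmul_comm (single x), adjoint_mul_single, htmul_smul,
    smul_htmul, smul_smul, mul_comm]

/-- The commutative Hilbertian algebra `ℓ²_•(X)`. -/
def alg (X : WPSet.{u}) : HilbAlg.{u} where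
  carrier := Ell2 X
  mul := mul X
  assoc := htensor_ext₃ fun v w z => by ext x; simp [mul_assoc]
  comm := htensor_ext fun v w => by ext x; simp [mul_comm]

theorem isFrobenius (X : WPSet.{u}) : (alg X).IsFrobenius :=
  ⟨frobenius_left X, frobenius_right X⟩

theorem isGroupLike_single (x : X.Off) :
    HilbAlg.IsGroupLike (A := alg X) ((X.weight x : ℂ)⁻¹ • single x : Ell2 X) := by
  have hx : (X.weight x : ℂ)⁻¹ ≠ 0 := inv_ne_zero (by exact_mod_cast (X.weight_pos x).ne')
  refine ⟨fun h => hx ?_, ?_⟩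
  · classical
    have h0 : ((X.weight x : ℂ)⁻¹ • single x : Ell2 X) x = 0 :=
      congrArg (fun v : Ell2 X => v x) h
    rw [smul_apply, single_apply, if_pos rfl, mul_one] at h0
    exact h0
  · change ContinuousLinearMap.adjoint (mul X) ((X.weight x : ℂ)⁻¹ • single x) =
      htmul ((X.weight x : ℂ)⁻¹ • single x) ((X.weight x : ℂ)⁻¹ • single x)
    rw [map_smul, adjoint_mul_single, htmul_smul, smul_htmul]

theorem eq_zero_of_inner_single (v : Ell2 X) (x : X.Off)
    (h : inner ℂ ((X.weight x : ℂ)⁻¹ • single x) v = 0) : v x = 0 := by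
  have e : inner ℂ ((X.weight x : ℂ)⁻¹ • single x) v =
      starRingEnd ℂ (X.weight x : ℂ)⁻¹ * inner ℂ (single x) v := inner_smul_left _ _ _
  have hx : (X.weight x : ℂ) ≠ 0 := by exact_mod_cast (X.weight_pos x).ne'
  rw [e, inner_single] at h
  simpa [hx] using h

theorem isSemisimple (X : WPSet.{u}) : (alg X).IsSemisimple := by
  refine (Submodule.eq_bot_iff _).2 fun v hv => ?_
  refine ext_off (w := 0) fun x => ?_
  have h := (Submodule.mem_orthogonal _ _).1 (isGroupLike_single x).mem_radical_orthogonal v hv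
  exact eq_zero_of_inner_single v x (inner_eq_zero_symm.1 h)

theorem exists_norm_comp_le (f : X ⟶ Y) : ∃ M : ℝ, 0 ≤ M ∧ ∀ (v : Ell2 Y) (s : Finset X.Off),
    ∑ x ∈ s, X.weight x * ‖v (WPSet.Hom.toFun f x)‖ ^ 2 ≤ M * ‖v‖ ^ 2 := by
  classical
  obtain ⟨M, hM, h⟩ := WPSet.Hom.exists_finset_bound f
  refine ⟨M, hM, fun v s => ?_⟩
  let s' : Finset X.Off := s.filter fun x => WPSet.Hom.toFun f x ≠ Y.pt
  have hs' : ∀ x ∈ s', WPSet.Hom.toFun f x ≠ Y.pt := fun x hx => (Finset.mem_filter.1 hx).2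
  let φ : s' → Y.Off := fun x => ⟨WPSet.Hom.toFun f x.1, hs' x.1 x.2⟩
  let t : Finset Y.Off := s'.attach.image φ
  calc ∑ x ∈ s, X.weight x * ‖v (WPSet.Hom.toFun f x)‖ ^ 2
      = ∑ x ∈ s', X.weight x * ‖v (WPSet.Hom.toFun f x)‖ ^ 2 := by
        refine (Finset.sum_filter_of_ne fun x _ hne => ?_).symm
        intro h0
        apply hne
        rw [h0]; simp
    _ = ∑ x ∈ s'.attach, X.weight x * ‖v (φ x)‖ ^ 2 := (Finset.sum_attach s' _).symm
    _ = ∑ y ∈ t, ∑ x ∈ s'.attach.filter (fun x => φ x = y), X.weight x * ‖v (φ x)‖ ^ 2 :=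
        (Finset.sum_fiberwise_of_maps_to (fun x hx => Finset.mem_image_of_mem _ hx) _).symm
    _ ≤ ∑ y ∈ t, M * (Y.weight y * ‖v y‖ ^ 2) := by
        refine Finset.sum_le_sum fun y _ => ?_
        have h1 : ∑ x ∈ s'.attach.filter (fun x => φ x = y), X.weight x * ‖v (φ x)‖ ^ 2 =
            (∑ x ∈ (s'.attach.filter (fun x => φ x = y)).map (Function.Embedding.subtype _),
              X.weight x) * ‖v y‖ ^ 2 := by
          rw [Finset.sum_map, Finset.sum_mul]
          refine Finset.sum_congr rfl fun x hx => ?_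
          rw [(Finset.mem_filter.1 hx).2]; rfl
        rw [h1, ← mul_assoc]
        refine mul_le_mul_of_nonneg_right (h y _ fun x hx => ?_) (sq_nonneg _)
        obtain ⟨z, hz, rfl⟩ := Finset.mem_map.1 hx
        have hzy : φ z = y := (Finset.mem_filter.1 hz).2
        exact congrArg Subtype.val hzy
    _ = M * ∑ y ∈ t, Y.weight y * ‖v y‖ ^ 2 := by rw [Finset.mul_sum]
    _ ≤ M * ‖v‖ ^ 2 := mul_le_mul_of_nonneg_left (sum_le_hasSum t
        (fun y _ => mul_nonneg (Y.weight_pos y).le (sq_nonneg _)) (hasSum_norm_sq v)) hM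

/-- Precomposition `v ↦ v ∘ f` as a linear map. -/
def compLin (f : X ⟶ Y) : Ell2 Y →ₗ[ℂ] Ell2 X where
  toFun v := ⟨fun x => v (WPSet.Hom.toFun f x), (congrArg v.1 (WPSet.Hom.map_pt f)).trans v.pt_eq, by
    obtain ⟨M, -, h⟩ := exists_norm_comp_le f
    exact summable_of_sum_le (fun x => mul_nonneg (X.weight_pos x).le (sq_nonneg _)) (h v)⟩
  map_add' v w := rfl
  map_smul' c v := rfl

/-- Precomposition `v ↦ v ∘ f` as a bounded linear map. -/
def compCLM (f : X ⟶ Y) : Ell2 Y →L[ℂ] Ell2 X :=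
  (compLin f).mkContinuousOfExistsBound (by
    obtain ⟨M, hM, h⟩ := exists_norm_comp_le f
    refine ⟨Real.sqrt M, fun v => (sq_le_sq₀ (norm_nonneg _) (by positivity)).1 ?_⟩
    rw [mul_pow, Real.sq_sqrt hM]
    exact norm_sq_le (h v))

@[simp] theorem compCLM_apply (f : X ⟶ Y) (v : Ell2 Y) (x : X.carrier) :
    compCLM f v x = v (WPSet.Hom.toFun f x) := rfl

/-- The morphism of semigroups `v ↦ v ∘ f`. -/
def map (f : X ⟶ Y) : alg Y ⟶ alg X where
  toCLM := compCLM f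
  map_mul := htensor_ext (H := Ell2 Y) (K := Ell2 Y) (E := Ell2 X)
    (f := compCLM f ∘L mul Y) (g := mul X ∘L hmap (compCLM f) (compCLM f))
    fun v w => by ext x; simp

end Ell2

/-- The functor `ℓ²_•`. -/
def ell2Functor : WPSet.{u}ᵒᵖ ⥤ FrobSem.{u} where
  obj X := ⟨Ell2.alg X.unop, Ell2.isFrobenius X.unop⟩
  map f := ObjectProperty.homMk (Ell2.map f.unop)
  map_id _ := rfl
  map_comp _ _ := rfl

/-- The functor `ℓ²_•`, with values in the semisimple Hilbertian Frobenius semigroups. -/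
def ell2SemisimpleFunctor : WPSet.{u}ᵒᵖ ⥤ SemisimpleFrobSem.{u} :=
  ObjectProperty.lift _ ell2Functor fun X => Ell2.isSemisimple X.unop

/-- The restriction of `Min_•` to the semisimple Hilbertian Frobenius semigroups. -/
def minSemisimpleFunctor : SemisimpleFrobSem.{u} ⥤ WPSet.{u}ᵒᵖ :=
  ObjectProperty.ι _ ⋙ minFunctor

end

end HilbFrob

/-!
A maximal modular ideal `M` of `A` is closed and, by Gelfand–Mazur, `A ⧸ M` is one-dimensional.
Hence `M = gᗮ` for some `g`, and normalizing `g` against a unit modulo `M` makes `⟪g, ·⟫`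
multiplicative, that is, `g` group-like. So `A` is semisimple exactly when no nonzero vector is
orthogonal to all group-like elements.

Distinct group-like elements are orthogonal, so by Bessel's inequality the Gelfand transform
`v ↦ (I ↦ ⟪g_I, v⟫)` is a coisometry of `A` onto `ℓ²_•(Min_• A)`: the weights `‖g_I‖⁻²` are
those for which the evaluation vector at `I` has the norm of its adjoint image `g_I`. It is the
unit of the adjunction, and it is injective when `A` is semisimple. The group-like elements of
`ℓ²_•(X)` are exactly the evaluation vectors at the points `x ≠ x₀`, so the counit is always an
isomorphism. On finite pointed sets the weights neither constrain the maps nor distinguish objects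
up to isomorphism.
-/

namespace HilbFrob

noncomputable section

namespace HilbAlg

variable {A : HilbAlg.{u}} {I J M : Submodule ℂ A}

/-! ### Maximal modular ideals -/

theorem norm_mulOp_le (x : A) : ‖A.mulOp x‖ ≤ ‖A.mul‖ * ‖x‖ :=
  (A.mulOp x).opNorm_le_bound (by positivity) fun y => by
    rw [mul_assoc]
    exact norm_prod_le x y

theorem exists_sub_prod_eq {x : A} (hx : ‖A.mulOp x‖ < 1) : ∃ y, y - A.prod x y = x := by
  obtain ⟨T, hT⟩ := (isUnit_one_sub_of_norm_lt_one hx).exists_right_inv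
  exact ⟨T x, congrArg (fun S => S x) hT⟩

theorem isIdeal_range_mulOp (x : A) : IsIdeal (A.mulOp x).range := by
  rintro y _ ⟨z, rfl⟩
  refine ⟨A.prod y z, ?_⟩
  change A.prod x (A.prod y z) = A.prod y (A.prod x z)
  rw [← prod_assoc, prod_comm x y, prod_assoc]

theorem IsIdeal.sup (hI : IsIdeal I) (hJ : IsIdeal J) : IsIdeal (I ⊔ J) := by
  intro x y hy
  obtain ⟨i, hi, j, hj, rfl⟩ := Submodule.mem_sup.1 hy
  rw [prod_add]
  exact Submodule.add_mem_sup (hI x i hi) (hJ x j hj)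

theorem IsIdeal.topologicalClosure (hI : IsIdeal I) : IsIdeal I.topologicalClosure :=
  fun x _ hy => map_mem_closure (A.mulOp x).continuous hy fun z hz => hI x z hz

theorem IsIdeal.eq_top_of_mem (hI : IsIdeal I) {e : A} (he : ∀ x, x - A.prod e x ∈ I)
    (heI : e ∈ I) : I = ⊤ := by
  refine eq_top_iff.2 fun x _ => (I.sub_mem_iff_left ?_).1 (he x)
  rw [prod_comm]
  exact hI x e heI

theorem IsIdeal.notMem_topologicalClosure (hI : IsIdeal I) (hne : I ≠ ⊤) {e : A}
    (he : ∀ x, x - A.prod e x ∈ I) : e ∉ I.topologicalClosure := by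
  intro hcl
  obtain ⟨m, hm, hdist⟩ := Metric.mem_closure_iff.1 hcl (1 / (‖A.mul‖ + 1)) (by positivity)
  have hsmall : ‖A.mulOp (e - m)‖ < 1 := by
    rw [dist_eq_norm, lt_div_iff₀ (by positivity)] at hdist
    refine (norm_mulOp_le _).trans_lt (lt_of_le_of_lt ?_ hdist)
    rw [mul_comm]
    gcongr
    exact le_add_of_nonneg_right zero_le_one
  obtain ⟨y, hy⟩ := exists_sub_prod_eq hsmall
  have he_eq : e = (y - A.prod e y) + A.prod y m + m := by
    rw [sub_prod, prod_comm m] at hy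
    rw [← sub_eq_iff_eq_add, ← hy]
    abel
  refine hne (hI.eq_top_of_mem he ?_)
  rw [he_eq]
  exact I.add_mem (I.add_mem (he y) (hI y m hm)) hm

/-- Multiplication by an element of the algebra, as an operator on the quotient by an ideal. -/
def IsIdeal.quotMulOp (hI : IsIdeal I) : A →ₗ[ℂ] (A ⧸ I →L[ℂ] A ⧸ I) where
  toFun x := I.liftQL (I.mkQL ∘L A.mulOp x) fun y hy =>
    (Submodule.Quotient.mk_eq_zero I).2 (hI x y hy)
  map_add' x y := by
    ext t
    obtain ⟨z, rfl⟩ := I.mkQ_surjective t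
    exact congrArg I.mkQ (add_prod x y z)
  map_smul' c x := by
    ext t
    obtain ⟨z, rfl⟩ := I.mkQ_surjective t
    exact congrArg I.mkQ (smul_prod c x z)

theorem IsIdeal.quotMulOp_mkQ (hI : IsIdeal I) (x y : A) :
    hI.quotMulOp x (I.mkQ y) = I.mkQ (A.prod x y) := rfl

theorem IsIdeal.quotMulOp_prod (hI : IsIdeal I) (x y : A) :
    hI.quotMulOp (A.prod x y) = hI.quotMulOp x * hI.quotMulOp y := by
  ext t
  obtain ⟨z, rfl⟩ := I.mkQ_surjective t
  exact congrArg I.mkQ (prod_assoc x y z)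

theorem IsIdeal.quotMulOp_of_mem (hI : IsIdeal I) {x : A} (hx : x ∈ I) :
    hI.quotMulOp x = 0 := by
  ext t
  obtain ⟨z, rfl⟩ := I.mkQ_surjective t
  rw [quotMulOp_mkQ, prod_comm]
  exact (Submodule.Quotient.mk_eq_zero I).2 (hI z x hx)

theorem IsIdeal.quotMulOp_of_sub_mem (hI : IsIdeal I) {e x : A} (he : ∀ y, y - A.prod e y ∈ I)
    (hx : x - e ∈ I) : hI.quotMulOp x = 1 := by
  have hxe : hI.quotMulOp x = hI.quotMulOp e := by
    rw [← sub_eq_zero, ← map_sub, hI.quotMulOp_of_mem hx]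
  ext t
  obtain ⟨z, rfl⟩ := I.mkQ_surjective t
  rw [hxe, quotMulOp_mkQ]
  exact ((Submodule.Quotient.eq I).2 (he z)).symm

theorem IsMaximalModular.isIdeal (hM : IsMaximalModular M) : IsIdeal M := hM.2.1.1

theorem IsMaximalModular.ne_top (hM : IsMaximalModular M) : M ≠ ⊤ := hM.2.1.2

theorem IsMaximalModular.eq_top_of_lt (hM : IsMaximalModular M) {I : Submodule ℂ A}
    (hI : IsIdeal I) (hlt : M < I) : I = ⊤ := by
  by_contra hne
  exact hlt.not_ge (hM.2.2 ⟨hI, hne⟩ hlt.le)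

theorem IsMaximalModular.isClosed (hM : IsMaximalModular M) : IsClosed (M : Set A) := by
  obtain ⟨e, he⟩ := hM.1
  by_contra hcl
  have hlt : M < M.topologicalClosure := M.le_topologicalClosure.lt_of_ne fun h =>
    hcl (h ▸ M.isClosed_topologicalClosure)
  refine hM.isIdeal.notMem_topologicalClosure hM.ne_top he ?_
  rw [hM.eq_top_of_lt hM.isIdeal.topologicalClosure hlt]
  exact Submodule.mem_top

theorem IsMaximalModular.exists_prod_sub_mem (hM : IsMaximalModular M) {e : A}
    (he : ∀ x, x - A.prod e x ∈ M) {x : A} (hx : x ∉ M) : ∃ y, A.prod x y - e ∈ M := by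
  have hxK : x ∈ M ⊔ (A.mulOp x).range :=
    Submodule.mem_sup.2 ⟨_, he x, A.prod e x, ⟨e, prod_comm x e⟩, sub_add_cancel _ _⟩
  have htop : M ⊔ (A.mulOp x).range = ⊤ :=
    hM.eq_top_of_lt (hM.isIdeal.sup (isIdeal_range_mulOp x))
      (le_sup_left.lt_of_ne fun h => hx (h ▸ hxK))
  obtain ⟨m, hm, _, ⟨y, rfl⟩, hmy⟩ := Submodule.mem_sup.1 (htop ▸ Submodule.mem_top : e ∈ _)
  refine ⟨y, ?_⟩
  rw [← hmy]
  change A.prod x y - (m + A.prod x y) ∈ M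
  rw [sub_add_cancel_right]
  exact M.neg_mem hm

theorem IsMaximalModular.isUnit_quotMulOp (hM : IsMaximalModular M) {x : A} (hx : x ∉ M) :
    IsUnit (hM.isIdeal.quotMulOp x) := by
  obtain ⟨e, he⟩ := hM.1
  obtain ⟨y, hy⟩ := hM.exists_prod_sub_mem he hx
  refine isUnit_iff_exists.2 ⟨hM.isIdeal.quotMulOp y, ?_, ?_⟩ <;> rw [← IsIdeal.quotMulOp_prod]
  · exact hM.isIdeal.quotMulOp_of_sub_mem he hy
  · exact hM.isIdeal.quotMulOp_of_sub_mem he (prod_comm x y ▸ hy)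

theorem IsMaximalModular.exists_smul_sub_mem (hM : IsMaximalModular M) {e : A}
    (he : ∀ x, x - A.prod e x ∈ M) (x : A) : ∃ c : ℂ, c • e - x ∈ M := by
  -- Gelfand–Mazur: any point of the spectrum of multiplication by `x` on `A ⧸ M` will do.
  have : IsClosed (M : Set A) := hM.isClosed
  have : Nontrivial (A ⧸ M) := Submodule.Quotient.nontrivial_iff.2 hM.ne_top
  obtain ⟨c, hc⟩ := spectrum.nonempty (hM.isIdeal.quotMulOp x)
  refine ⟨c, by_contra fun hne => hc ?_⟩
  have hone : hM.isIdeal.quotMulOp e = 1 :=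
    hM.isIdeal.quotMulOp_of_sub_mem he (by rw [sub_self]; exact M.zero_mem)
  rw [spectrum.mem_resolventSet_iff, Algebra.algebraMap_eq_smul_one, ← hone, ← map_smul, ← map_sub]
  exact hM.isUnit_quotMulOp hne

end HilbAlg

/-! ### Group-like elements -/

theorem exists_mem_orthogonal_inner_eq_one {𝕜 E : Type*} [RCLike 𝕜] [NormedAddCommGroup E]
    [InnerProductSpace 𝕜 E] {K : Submodule 𝕜 E} [K.HasOrthogonalProjection] {x : E} (hx : x ∉ K) :
    ∃ g ∈ Kᗮ, inner 𝕜 g x = 1 := by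
  obtain ⟨y, hy, p, hp, rfl⟩ := K.exists_add_mem_mem_orthogonal x
  have hp0 : p ≠ 0 := fun h => hx (by simpa only [h, add_zero] using hy)
  refine ⟨(inner 𝕜 p p : 𝕜)⁻¹ • p, Kᗮ.smul_mem _ hp, ?_⟩
  rw [inner_smul_left, inner_add_right, Submodule.inner_left_of_mem_orthogonal hy hp, zero_add,
    map_inv₀, inner_self_conj, inv_mul_cancel₀ (inner_self_ne_zero.2 hp0)]

namespace HilbAlg

variable {A : HilbAlg.{u}}

theorem isGroupLike_of_inner_prod {g : A} (hg : g ≠ 0)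
    (hmul : ∀ x y : A, inner ℂ g (A.prod x y) = inner ℂ g x * inner ℂ g y) : IsGroupLike g :=
  ⟨hg, htensor_ext_inner fun x y => by rw [inner_comul, inner_htmul, hmul]⟩

theorem IsMaximalModular.exists_eq_orthogonal {M : Submodule ℂ A} (hM : IsMaximalModular M) :
    ∃ g : A, IsGroupLike g ∧ M = (ℂ ∙ g)ᗮ := by
  obtain ⟨e, he⟩ := hM.1
  have : CompleteSpace M := hM.isClosed.completeSpace_coe
  obtain ⟨g, hg, hge⟩ := exists_mem_orthogonal_inner_eq_one fun heM =>
    hM.ne_top (hM.isIdeal.eq_top_of_mem he heM)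
  have hgM : ∀ y ∈ M, inner ℂ g y = 0 := fun y hy => Submodule.inner_left_of_mem_orthogonal hy hg
  have hquot : ∀ x, (inner ℂ g x : ℂ) • e - x ∈ M := fun x => by
    obtain ⟨c, hc⟩ := hM.exists_smul_sub_mem he x
    have hcx := hgM _ hc
    rw [inner_sub_right, inner_smul_right, hge, mul_one, sub_eq_zero] at hcx
    rwa [← hcx]
  have hmul : ∀ x y : A, inner ℂ g (A.prod x y) = inner ℂ g x * inner ℂ g y := fun x y => by
    have hx := hgM _ (hM.isIdeal y _ (hquot x))
    have hy := hgM _ (he y)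
    rw [prod_sub, prod_smul, inner_sub_right, inner_smul_right, sub_eq_zero, prod_comm y x,
      prod_comm y e] at hx
    rw [inner_sub_right, sub_eq_zero] at hy
    rw [← hx, ← hy]
  have hg0 : g ≠ 0 := by
    rintro rfl
    exact zero_ne_one ((inner_zero_left e).symm.trans hge)
  refine ⟨g, isGroupLike_of_inner_prod hg0 hmul, le_antisymm (fun y hy => ?_) fun x hx => ?_⟩
  · exact Submodule.mem_orthogonal_singleton_iff_inner_right.2 (hgM y hy)
  · simpa [Submodule.mem_orthogonal_singleton_iff_inner_right.1 hx] using hquot x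

theorem IsSemisimple.eq_zero_of_inner_groupLike (hA : A.IsSemisimple) {v : A}
    (hv : ∀ g, IsGroupLike g → inner ℂ g v = 0) : v = 0 := by
  have hrad : v ∈ A.radical := Submodule.mem_sInf.2 fun M hM => by
    obtain ⟨g, hg, rfl⟩ := hM.exists_eq_orthogonal
    exact Submodule.mem_orthogonal_singleton_iff_inner_right.2 (hv g hg)
  rwa [hA, Submodule.mem_bot] at hrad

theorem orthonormal_groupLike (hA : A.IsFrobenius) :
    Orthonormal ℂ fun g : {g : A // IsGroupLike g} => (‖g.1‖ : ℂ)⁻¹ • g.1 := by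
  refine ⟨fun g => norm_smul_inv_norm g.2.1, fun g k hne => ?_⟩
  simp only [inner_smul_left, inner_smul_right,
    g.2.inner_eq_zero hA k.2 fun h => hne (Subtype.ext h), mul_zero]

theorem finite_setOf_isGroupLike [FiniteDimensional ℂ A] (hA : A.IsFrobenius) :
    {g : A | IsGroupLike g}.Finite :=
  (orthonormal_groupLike hA).linearIndependent.finite

/-- Minimal ideals, together with `⊥`, correspond to group-like elements, together with `0`. -/
def genEquiv (hA : A.IsFrobenius) : A.MinIdeal ≃ {g : A // g = 0 ∨ IsGroupLike g} where
  toFun I := ⟨gen I.1, I.gen_eq_zero_or hA⟩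
  invFun g := lineOf hA g.1 g.2
  left_inv I := Subtype.ext (I.span_gen hA)
  right_inv g := Subtype.ext (gen_lineOf hA g.1 g.2)

theorem MinIdeal.ext_gen (hA : A.IsFrobenius) {I J : A.MinIdeal} (h : gen I.1 = gen J.1) : I = J :=
  (genEquiv hA).injective (Subtype.ext h)

theorem MinIdeal.inner_gen_prod (hA : A.IsFrobenius) (I : A.MinIdeal) (v w : A) :
    (inner ℂ (gen I.1) (A.prod v w) : ℂ) = inner ℂ (gen I.1) v * inner ℂ (gen I.1) w := by
  rcases I.gen_eq_zero_or hA with h | h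
  · simp only [h, inner_zero_left, mul_zero]
  · exact h.inner_prod v w

theorem MinIdeal.finite [FiniteDimensional ℂ A] (hA : A.IsFrobenius) : Finite A.MinIdeal := by
  have : Finite {g : A // g = 0 ∨ IsGroupLike g} := (finite_setOf_isGroupLike hA).insert 0
  exact .of_equiv _ (genEquiv hA).symm

theorem isIso_of_bijective {B : HilbAlg.{u}} (f : A ⟶ B)
    (hf : Function.Bijective (Hom.toCLM f)) : IsIso f := by
  let e := ContinuousLinearEquiv.ofBijective (Hom.toCLM f) (LinearMap.ker_eq_bot.2 hf.1)
    (LinearMap.range_eq_top.2 hf.2)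
  let inv : B ⟶ A := Hom.ofProd e.symm fun v w => e.injective <| by
    refine Eq.trans ?_ (Hom.map_prod f (e.symm v) (e.symm w)).symm
    exact (e.apply_symm_apply _).trans
      (congrArg₂ B.prod (e.apply_symm_apply v) (e.apply_symm_apply w)).symm
  exact ⟨inv, Hom.ext (ContinuousLinearMap.ext e.symm_apply_apply),
    Hom.ext (ContinuousLinearMap.ext e.apply_symm_apply)⟩

end HilbAlg

/-! ### Weighted pointed sets -/

namespace WPSet

variable {X Y : WPSet.{u}}

/-- An injective base-point preserving map that does not decrease the weights, as a morphism. -/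
def Hom.ofInjective (f : X.carrier → Y.carrier) (hinj : Function.Injective f) (hf : f X.pt = Y.pt)
    (hw : ∀ (x : X.Off) (y : Y.Off), f x = y → X.weight x ≤ Y.weight y) : X ⟶ Y :=
  Hom.ofFinset f hf ⟨1, zero_le_one, fun y s hs => by
    rcases s.eq_empty_or_nonempty with rfl | ⟨x, hx⟩
    · simpa only [Finset.sum_empty, one_mul] using (Y.weight_pos y).le
    · have hsx : s = {x} := Finset.eq_singleton_iff_unique_mem.2
        ⟨hx, fun z hz => Subtype.ext (hinj ((hs z hz).trans (hs x hx).symm))⟩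
      rw [hsx, Finset.sum_singleton, one_mul]
      exact hw x y (hs x hx)⟩

/-- A base-point and weight preserving bijection, as an isomorphism. -/
def isoOfEquiv (e : X.carrier ≃ Y.carrier) (he : e X.pt = Y.pt)
    (hw : ∀ (x : X.Off) (y : Y.Off), e x = y → X.weight x = Y.weight y) : X ≅ Y where
  hom := Hom.ofInjective e e.injective he fun x y h => (hw x y h).le
  inv := Hom.ofInjective e.symm e.symm.injective (e.symm_apply_eq.2 he.symm)
    fun y x h => (hw x y (e.symm_apply_eq.1 h).symm).ge
  hom_inv_id := hom_ext e.symm_apply_apply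
  inv_hom_id := hom_ext e.apply_symm_apply

/-- A base-point preserving map from a finite weighted pointed set, as a morphism: the total weight
of the source divided by a lower bound of the weights of the target bounds its fibres. -/
def Hom.ofFinite [Finite X.carrier] (f : X.carrier → Y.carrier) (hf : f X.pt = Y.pt) : X ⟶ Y :=
  Hom.ofFinset f hf <| by
    have := Fintype.ofFinite X.Off
    obtain ⟨C, hC, hY⟩ := Y.exists_le
    have htotal : 0 ≤ ∑ x, X.weight x := Finset.sum_nonneg fun x _ => (X.weight_pos x).le
    refine ⟨(∑ x, X.weight x) / C, by positivity, fun y s _ => ?_⟩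
    calc ∑ x ∈ s, X.weight x ≤ ∑ x, X.weight x :=
          Finset.sum_le_sum_of_subset_of_nonneg s.subset_univ fun x _ _ => (X.weight_pos x).le
      _ = (∑ x, X.weight x) / C * C := (div_mul_cancel₀ _ hC.ne').symm
      _ ≤ (∑ x, X.weight x) / C * Y.weight y := mul_le_mul_of_nonneg_left (hY y) (by positivity)

/-- A pointed set with all weights equal to `1`. -/
def unitWeight (P : Pointed.{u}) : WPSet.{u} :=
  ⟨P, P.point, fun _ => 1, 1, one_pos, fun _ => le_rfl⟩

instance : forgetWeight.{u}.Faithful where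
  map_injective h := hom_ext (congrFun (congrArg Pointed.Hom.toFun h))

end WPSet

/-! ### The Gelfand transform -/

open HilbAlg

section

variable (A : FrobSem.{u})

theorem orthonormal_gen :
    Orthonormal ℂ fun I : (minObj A).Off => (‖gen I.1.1‖ : ℂ)⁻¹ • gen I.1.1 :=
  (orthonormal_groupLike A.property).comp
    (fun I : (minObj A).Off => ⟨gen I.1.1, minObj_isGroupLike A I⟩)
    fun _ _ h => Subtype.ext (MinIdeal.ext_gen A.property (Subtype.ext_iff.1 h))

theorem sum_weight_mul_inner_gen_le (v : A.obj) (s : Finset (minObj A).Off) :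
    ∑ I ∈ s, (minObj A).weight I * ‖(inner ℂ (gen I.1.1) v : ℂ)‖ ^ 2 ≤ ‖v‖ ^ 2 := by
  refine ((orthonormal_gen A).sum_inner_products_le (s := s) v).trans_eq'
    (Finset.sum_congr rfl fun I _ => ?_)
  simp only [inner_smul_left, norm_mul, map_inv₀, Complex.conj_ofReal, norm_inv,
    Complex.norm_real, norm_norm, mul_pow, inv_pow, minObj, one_div]

/-- The map `v ↦ (I ↦ ⟪g_I, v⟫)`, where `g_I` is the group-like generator of `I`. -/
def gelfandLin : A.obj →ₗ[ℂ] Ell2 (minObj A) where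
  toFun v := ⟨fun I => inner ℂ (gen I.1) v,
    (congrArg (fun g : A.obj => (inner ℂ g v : ℂ)) gen_bot).trans (inner_zero_left v),
    summable_of_sum_le (fun I => mul_nonneg ((minObj A).weight_pos I).le (sq_nonneg _))
      (sum_weight_mul_inner_gen_le A v)⟩
  map_add' v w := Ell2.ext fun _ => inner_add_right _ v w
  map_smul' c v := Ell2.ext fun _ => inner_smul_right _ v c

/-- The map `gelfandLin` as a contraction; the bound is Bessel's inequality. -/
def gelfandCLM : A.obj →L[ℂ] Ell2 (minObj A) :=
  (gelfandLin A).mkContinuous 1 fun v => by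
    rw [one_mul]
    exact (sq_le_sq₀ (norm_nonneg _) (norm_nonneg _)).1
      (Ell2.norm_sq_le (sum_weight_mul_inner_gen_le A v))

theorem gelfandCLM_apply (v : A.obj) (I : A.obj.MinIdeal) :
    gelfandCLM A v I = inner ℂ (gen I.1) v := rfl

/-- The Gelfand transform as a morphism of Frobenius semigroups. -/
def gelfand : A ⟶ ell2Functor.obj (Opposite.op (minObj A)) :=
  ObjectProperty.homMk (Hom.ofProd (B := Ell2.alg (minObj A)) (gelfandCLM A) fun v w => by
    refine Eq.trans ?_ (Ell2.mul_htmul (gelfandCLM A v) (gelfandCLM A w)).symm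
    exact Ell2.ext fun I => I.inner_gen_prod A.property v w)

end

/-! ### Group-like elements of weighted `ℓ²` spaces -/

namespace Ell2

variable {X Y : WPSet.{u}}

open Classical in
/-- The vector representing the evaluation `v ↦ v x`. -/
def evalVec (x : X.carrier) : Ell2 X :=
  if h : x = X.pt then 0 else (X.weight ⟨x, h⟩ : ℂ)⁻¹ • single ⟨x, h⟩

theorem evalVec_pt : evalVec X.pt = 0 := dif_pos rfl

theorem evalVec_off (x : X.Off) : evalVec (x : X.carrier) = (X.weight x : ℂ)⁻¹ • single x :=
  dif_neg x.2

open Classical in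
theorem evalVec_off_apply (x : X.Off) (y : X.carrier) :
    evalVec (x : X.carrier) y = if y = x then (X.weight x : ℂ)⁻¹ else 0 := by
  rw [evalVec_off, smul_apply, single_apply, mul_ite, mul_one, mul_zero]

theorem ofReal_weight_ne_zero (x : X.Off) : (X.weight x : ℂ) ≠ 0 :=
  Complex.ofReal_ne_zero.2 (X.weight_pos x).ne'

theorem single_eq_smul_evalVec (x : X.Off) :
    single x = (X.weight x : ℂ) • evalVec (x : X.carrier) := by
  rw [evalVec_off, smul_inv_smul₀ (ofReal_weight_ne_zero x)]

theorem inner_evalVec (x : X.carrier) (v : Ell2 X) : inner ℂ (evalVec x) v = v x := by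
  by_cases h : x = X.pt
  · rw [h, evalVec_pt, inner_zero_left, pt_eq]
  · lift x to X.Off using h
    rw [evalVec_off, inner_smul_left, inner_single, map_inv₀, Complex.conj_ofReal,
      inv_mul_cancel_left₀ (ofReal_weight_ne_zero x)]

theorem norm_evalVec_sq (x : X.Off) : ‖evalVec (x : X.carrier)‖ ^ 2 = (X.weight x)⁻¹ := by
  rw [norm_sq_eq_re_inner (𝕜 := ℂ), inner_evalVec, evalVec_off_apply, if_pos rfl,
    ← Complex.ofReal_inv]
  exact Complex.ofReal_re _

theorem eq_of_forall_apply_eq {x y : X.carrier} (h : ∀ v : Ell2 X, v x = v y) : x = y := by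
  by_contra hne
  wlog hx : x ≠ X.pt generalizing x y
  · exact this (fun v => (h v).symm) (Ne.symm hne)
      fun hy => hne ((not_not.1 hx).trans hy.symm)
  have hxy := h (single ⟨x, hx⟩)
  rw [single_apply, single_apply, if_pos rfl, if_neg (Ne.symm hne)] at hxy
  exact one_ne_zero hxy

theorem evalVec_injective : Function.Injective (evalVec (X := X)) := fun x y h =>
  eq_of_forall_apply_eq fun v => by rw [← inner_evalVec x, h, inner_evalVec]

theorem isGroupLike_evalVec (x : X.Off) : IsGroupLike (A := alg X) (evalVec (x : X.carrier)) := by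
  rw [evalVec_off]
  exact isGroupLike_single x

theorem evalVec_eq_zero_or (x : X.carrier) :
    (evalVec x : alg X) = 0 ∨ IsGroupLike (A := alg X) (evalVec x) := by
  by_cases h : x = X.pt
  · exact .inl (h ▸ evalVec_pt)
  · exact .inr (isGroupLike_evalVec ⟨x, h⟩)

theorem exists_evalVec_eq {g : alg X} (hg : g = 0 ∨ IsGroupLike g) :
    ∃ x : X.carrier, evalVec x = g := by
  rcases hg with rfl | hg
  · exact ⟨X.pt, evalVec_pt⟩
  by_contra! hne
  -- otherwise `g` is orthogonal to all evaluation vectors, as distinct group-likes are orthogonal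
  refine hg.1 (ext_off (w := 0) fun x => ?_)
  exact (inner_evalVec x.1 (g : Ell2 X)).symm.trans
    ((isGroupLike_evalVec x).inner_eq_zero (isFrobenius X) hg (hne x))

/-- The points of `X` correspond to the minimal ideals of `ℓ²_•(X)`, together with `⊥`. -/
def pointEquiv (X : WPSet.{u}) : X.carrier ≃ (alg X).MinIdeal :=
  (Equiv.ofBijective (fun x => (⟨evalVec x, evalVec_eq_zero_or x⟩ :
      {g : alg X // g = 0 ∨ IsGroupLike g}))
    ⟨fun _ _ h => evalVec_injective (Subtype.ext_iff.1 h), fun g =>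
      (exists_evalVec_eq g.2).imp fun _ h => Subtype.ext h⟩).trans
    (genEquiv (isFrobenius X)).symm

theorem gen_pointEquiv (x : X.carrier) : gen (pointEquiv X x).1 = evalVec x :=
  gen_lineOf (isFrobenius X) (evalVec x : alg X) (evalVec_eq_zero_or x)

theorem pointEquiv_pt : (pointEquiv X X.pt).1 = ⊥ :=
  Submodule.span_singleton_eq_bot.2 (evalVec_pt (X := X))

/-- The counit of the adjunction at `X`, as an isomorphism of weighted pointed sets. -/
def pointIso (X : WPSet.{u}) : X ≅ minObj (ell2Functor.obj (Opposite.op X)) :=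
  WPSet.isoOfEquiv (pointEquiv X) (Subtype.ext pointEquiv_pt) fun x I h => by
    change X.weight x = 1 / ‖gen I.1.1‖ ^ 2
    have hgen : gen I.1.1 = evalVec x.1 := by
      rw [← h]
      exact gen_pointEquiv x.1
    rw [hgen, one_div]
    exact (inv_eq_iff_eq_inv.2 (norm_evalVec_sq x)).symm

theorem adjoint_compCLM_evalVec (f : X ⟶ Y) (x : X.carrier) :
    ContinuousLinearMap.adjoint (compCLM f) (evalVec x) = evalVec (WPSet.Hom.toFun f x) :=
  ext_inner_right ℂ fun v => by
    rw [ContinuousLinearMap.adjoint_inner_left, inner_evalVec, inner_evalVec, compCLM_apply]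

end Ell2

/-! ### The adjunctions -/

theorem frobSem_hom_ext {A B : FrobSem.{u}} {f g : A ⟶ B}
    (h : ∀ v, Hom.toCLM f.hom v = Hom.toCLM g.hom v) : f = g :=
  ObjectProperty.hom_ext _ (Hom.ext (ContinuousLinearMap.ext h))

theorem adjoint_gelfandCLM_evalVec (A : FrobSem.{u}) (I : A.obj.MinIdeal) :
    ContinuousLinearMap.adjoint (gelfandCLM A) (Ell2.evalVec (X := minObj A) I) = gen I.1 :=
  ext_inner_right ℂ fun v => by
    rw [ContinuousLinearMap.adjoint_inner_left]
    exact Ell2.inner_evalVec (X := minObj A) I (gelfandCLM A v)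

/-- The Gelfand transform as a natural transformation, the unit of the adjunction. -/
def gelfandNat : 𝟭 FrobSem.{u} ⟶ minFunctor.{u} ⋙ ell2Functor.{u} where
  app := gelfand
  naturality A B f := frobSem_hom_ext fun v => Ell2.ext fun (J : B.obj.MinIdeal) =>
    (ContinuousLinearMap.adjoint_inner_left (Hom.toCLM f.hom) v (gen J.1)).symm.trans
      (congrArg (fun g : A.obj => (inner ℂ g v : ℂ)) (gen_minMap f J).symm)

theorem minMap_map_pointEquiv {X Y : WPSet.{u}} (f : X ⟶ Y) (x : X.carrier) :
    WPSet.Hom.toFun (minMap (ell2Functor.map f.op)) (Ell2.pointEquiv X x) =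
      Ell2.pointEquiv Y (WPSet.Hom.toFun f x) :=
  MinIdeal.ext_gen (Ell2.isFrobenius Y) <| by
    refine (gen_minMap (ell2Functor.map f.op) (Ell2.pointEquiv X x)).trans ?_
    refine Eq.trans ?_ (Ell2.gen_pointEquiv (WPSet.Hom.toFun f x)).symm
    exact (congrArg (ContinuousLinearMap.adjoint (Ell2.compCLM f)) (Ell2.gen_pointEquiv x)).trans
      (Ell2.adjoint_compCLM_evalVec f x)

theorem minMap_gelfand_pointEquiv (A : FrobSem.{u}) (I : A.obj.MinIdeal) :
    WPSet.Hom.toFun (minMap (gelfand A)) (Ell2.pointEquiv (minObj A) I) = I :=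
  MinIdeal.ext_gen A.property <| by
    refine (gen_minMap (gelfand A) (Ell2.pointEquiv (minObj A) I)).trans ?_
    exact (congrArg (ContinuousLinearMap.adjoint (gelfandCLM A)) (Ell2.gen_pointEquiv _)).trans
      (adjoint_gelfandCLM_evalVec A I)

theorem gelfandCLM_pointEquiv {X : WPSet.{u}} (v : Ell2 X) (x : X.carrier) :
    gelfandCLM (ell2Functor.obj (Opposite.op X)) v (Ell2.pointEquiv X x) = v x :=
  (congrArg (fun g : Ell2 X => (inner ℂ g v : ℂ)) (Ell2.gen_pointEquiv x)).trans
    (Ell2.inner_evalVec x v)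

/-- The isomorphisms `pointIso` as a natural transformation, the counit of the adjunction. -/
def pointNat : ell2Functor.{u} ⋙ minFunctor.{u} ⟶ 𝟭 WPSet.{u}ᵒᵖ where
  app X := (Ell2.pointIso X.unop).hom.op
  naturality _ _ f := congrArg Quiver.Hom.op (WPSet.hom_ext (minMap_map_pointEquiv f.unop))

/-- The adjunction `Min_• ⊣ ℓ²_•`. -/
def minAdjunction : minFunctor.{u} ⊣ ell2Functor.{u} where
  unit := gelfandNat
  counit := pointNat
  left_triangle_components A := congrArg Quiver.Hom.op (WPSet.hom_ext (minMap_gelfand_pointEquiv A))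
  right_triangle_components _ := frobSem_hom_ext fun v => Ell2.ext (gelfandCLM_pointEquiv v)

/-- The adjunction `Min_• ⊣ ℓ²_•` between weighted pointed sets and semisimple objects. -/
def minSemisimpleAdjunction : minSemisimpleFunctor.{u} ⊣ ell2SemisimpleFunctor.{u} where
  unit :=
    { app := fun A => ObjectProperty.homMk (gelfandNat.app A.obj)
      naturality := fun _ _ f => ObjectProperty.hom_ext _ (gelfandNat.naturality f.hom) }
  counit :=
    { app := pointNat.app
      naturality := fun _ _ f => pointNat.naturality f }
  left_triangle_components A := minAdjunction.left_triangle_components A.obj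
  right_triangle_components X :=
    ObjectProperty.hom_ext _ (minAdjunction.right_triangle_components X)

/-! ### The equivalences -/

theorem gelfandCLM_comp_adjoint (A : FrobSem.{u}) :
    gelfandCLM A ∘L ContinuousLinearMap.adjoint (gelfandCLM A) =
      ContinuousLinearMap.id ℂ (Ell2 (minObj A)) := by
  refine Ell2.clm_ext fun I => ?_
  rw [Ell2.single_eq_smul_evalVec, map_smul, map_smul]
  refine congrArg (((minObj A).weight I : ℂ) • ·) (Ell2.ext_off fun J => ?_)
  have hJ : gelfandCLM A (ContinuousLinearMap.adjoint (gelfandCLM A) (Ell2.evalVec I.1)) J.1 =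
      inner ℂ (gen J.1.1) (gen I.1.1) :=
    congrArg (inner ℂ (gen J.1.1)) (adjoint_gelfandCLM_evalVec A I.1)
  refine hJ.trans (Eq.trans ?_ (Ell2.evalVec_off_apply I J.1).symm)
  split_ifs with h
  · rw [h, inner_self_eq_norm_sq_to_K]
    simp [minObj]
  · exact (minObj_isGroupLike A J).inner_eq_zero A.property (minObj_isGroupLike A I)
      fun hgen => h (MinIdeal.ext_gen A.property hgen)

theorem gelfandCLM_surjective (A : FrobSem.{u}) : Function.Surjective (gelfandCLM A) := fun w =>
  ⟨ContinuousLinearMap.adjoint (gelfandCLM A) w, DFunLike.congr_fun (gelfandCLM_comp_adjoint A) w⟩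

theorem gelfandCLM_injective {A : FrobSem.{u}} (hA : A.obj.IsSemisimple) :
    Function.Injective (gelfandCLM A) := by
  refine (injective_iff_map_eq_zero _).2 fun v hv => hA.eq_zero_of_inner_groupLike fun g hg => ?_
  rw [← gen_lineOf A.property g (.inr hg), ← gelfandCLM_apply, hv]
  rfl

instance isIso_minSemisimpleAdjunction_unit : IsIso minSemisimpleAdjunction.{u}.unit := by
  have (A : SemisimpleFrobSem.{u}) : IsIso (minSemisimpleAdjunction.unit.app A) := by
    have : IsIso (minSemisimpleAdjunction.unit.app A).hom.hom := isIso_of_bijective _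
      ⟨gelfandCLM_injective A.property, gelfandCLM_surjective A.obj⟩
    rw [← ObjectProperty.isIso_hom_iff, ← ObjectProperty.isIso_hom_iff]
    exact this
  exact NatIso.isIso_of_isIso_app _

instance isIso_minSemisimpleAdjunction_counit : IsIso minSemisimpleAdjunction.{u}.counit := by
  have (X : WPSet.{u}ᵒᵖ) : IsIso (minSemisimpleAdjunction.counit.app X) :=
    (Ell2.pointIso X.unop).op.isIso_hom
  exact NatIso.isIso_of_isIso_app _

instance : minSemisimpleFunctor.{u}.Full := minSemisimpleAdjunction.fullyFaithfulLOfIsIsoUnit.full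

instance : minSemisimpleFunctor.{u}.Faithful :=
  minSemisimpleAdjunction.fullyFaithfulLOfIsIsoUnit.faithful

theorem finiteDimensional_ell2 (X : WPSet.{u}) [Finite X.carrier] : FiniteDimensional ℂ (Ell2 X) :=
  inferInstanceAs (FiniteDimensional ℂ (ell2Submodule X))

theorem finite_minObj (A : FdSemisimpleFrobSem.{u}) : Finite (minObj A.obj.obj).carrier :=
  have : FiniteDimensional ℂ A.obj.obj.obj := A.property
  MinIdeal.finite A.obj.obj.property

/-- The functor `Min_•` on finite-dimensional semisimple objects, forgetting the weights. -/
def minFinFunctor : FdSemisimpleFrobSem.{u} ⥤ FinPointed.{u}ᵒᵖ :=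
  (ObjectProperty.lift (fun X : Pointed.{u} => Finite X)
    (ObjectProperty.ι _ ⋙ minSemisimpleFunctor ⋙ WPSet.forgetWeight.op).leftOp fun A =>
      finite_minObj A.unop).rightOp

instance : minFinFunctor.{u}.Faithful where
  map_injective h := ObjectProperty.hom_ext _ <| minSemisimpleFunctor.map_injective <|
    congrArg Quiver.Hom.op <| WPSet.forgetWeight.map_injective <|
      congrArg (fun k => k.unop.hom) h

instance : minFinFunctor.{u}.Full where
  map_surjective {A B} f := by
    have := finite_minObj B
    let k : minObj B.obj.obj ⟶ minObj A.obj.obj :=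
      WPSet.Hom.ofFinite f.unop.hom.toFun f.unop.hom.map_point
    obtain ⟨h, hk⟩ := minSemisimpleFunctor.map_surjective (X := A.obj) (Y := B.obj) k.op
    exact ⟨ObjectProperty.homMk h, congrArg Quiver.Hom.op <| ObjectProperty.hom_ext _ <|
      congrArg (fun φ => WPSet.forgetWeight.map (Quiver.Hom.unop φ)) hk⟩

instance : minFinFunctor.{u}.EssSurj where
  mem_essImage X := by
    let W := WPSet.unitWeight X.unop.obj
    have : Finite W.carrier := X.unop.property
    let A : FdSemisimpleFrobSem.{u} :=
      ⟨ell2SemisimpleFunctor.obj (Opposite.op W), finiteDimensional_ell2 W⟩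
    have e : X.unop ≅ (minFinFunctor.obj A).unop :=
      ObjectProperty.isoMk _ (WPSet.forgetWeight.mapIso (Ell2.pointIso W))
    exact ⟨A, ⟨e.op⟩⟩

instance : minFinFunctor.{u}.IsEquivalence where

end

end HilbFrob

theorem mainTheorem5 :
    (∃ (adj : HilbFrob.minFunctor.{u} ⊣ HilbFrob.ell2Functor.{u})
      (adjS : HilbFrob.minSemisimpleFunctor.{u} ⊣ HilbFrob.ell2SemisimpleFunctor.{u}),
      (∀ A, (adjS.unit.app A).hom = adj.unit.app A.obj) ∧
      (∀ X, adjS.counit.app X = adj.counit.app X) ∧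
      IsIso adjS.unit ∧ IsIso adjS.counit) ∧
    (∃ e : HilbFrob.FdSemisimpleFrobSem.{u} ≌ HilbFrob.FinPointed.{u}ᵒᵖ,
      Nonempty (e.functor ⋙ (ObjectProperty.ι fun X : Pointed.{u} => Finite X).op ≅
        (ObjectProperty.ι fun A : HilbFrob.SemisimpleFrobSem.{u} =>
          FiniteDimensional ℂ A.obj.obj.carrier) ⋙
          HilbFrob.minSemisimpleFunctor.{u} ⋙ HilbFrob.WPSet.forgetWeight.{u}.op)) := by
  refine ⟨⟨HilbFrob.minAdjunction, HilbFrob.minSemisimpleAdjunction, fun _ => rfl, fun _ => rfl,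
    inferInstance, inferInstance⟩, ?_⟩
  exact ⟨HilbFrob.minFinFunctor.asEquivalence, ⟨Iso.refl _⟩⟩
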